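/- Let $\mathbb C((z^{-1}))$ be the field of formal Laurent series $\sum_{k\le n}a_kz^k$ over $\mathbb C$; a nonzero series has order $n$ if $z^n$ is its highest power with nonzero coefficient. For $m\ge 0$ let $S_m=\{-m,-m+2,\dots,m,m+1,m+2,\dots\}$, and let $\Sigma_m$ be the set of subspaces $W\subset\mathbb C((z^{-1}))$ with $z^2W\subset W$ such that the set of orders of nonzero elements of $W$ is $S_m$. A canonical basis of $W\in\Sigma_m$ is a family $p_s\in W$ $(s\in S_m)$ with $p_s=z^s+(\text{lower powers})$ in which the coefficient of $z^i$ vanishes for all $i\in S_m$ with $0\le i<s$. A subspace $V$ is called closed if $V\cdot V\subset V$. Let $I=\{3,5,6,7,\dots\}$. (1) (Maximality.) Let $W\in\Sigma_5$. Every nonzero element of a closed subspace $V\subset W$ has order in $I$. If $(p_s)$ is a canonical basis of $W$ and $T\subset S_5$ is such that $\langle p_s\rangle_{s\in T}$ is closed, then $T\subset I$; and if $\langle p_s\rangle_{s\in I}$ is closed, it is maximal among the closed subspaces of $W$. (2) (Closedness.) Let $p_j=z^j+H^j_{-4}z^4+H^j_{-2}z^2+H^j_0+\sum_{k\ge1}H^j_kz^{-k}$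 for $j\in I$, with complex coefficients $H^j_k$ and $H^3_{-4}=0$. Then all products $p_jp_k$ are finite sums $\sum_{l\in I}C_{jk}^lp_l$ $(j,k\in I)$ and $z^2\langle p_i\rangle_{i\in I}\subset\langle p_i\rangle_{i\in I}$ if and only if $H^j_k=0$ for all $j\in I$, $k\ge1$ (so all $p_j$ are polynomials) and $$H^5_0=0,\quad H^5_{-2}=H^3_0,\quad H^5_{-4}=H^3_{-2},\qquad H^6_0=-(H^3_0)^2,\quad H^6_{-2}=-2H^3_0H^3_{-2},\quad H^6_{-4}=-(H^3_{-2})^2,$$ $$H^{j+2}_{-4}=H^j_{-2}-H^j_{-4}H^6_{-4},\quad H^{j+2}_{-2}=H^j_0-H^j_{-4}H^6_{-2},\quad H^{j+2}_0=-H^j_{-4}H^6_0\qquad(j\in I).\tag{$*$}$$ In that case, for $j,k,l\in I$, $$C_{jk}^l=\delta_{j+k}^l+\sum_{s=0}^2H^j_{-2s}\delta^l_{2s+k}+\sum_{s=0}^2H^k_{-2s}\delta^l_{2s+j}+\sum_{s,r=0}^2H^j_{-2s}H^k_{-2r}\delta^l_{2(r+s)}.\tag{$**$}$$ For all $a,b\in\mathbb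 C$ there is exactly one solution of $(*)$ (with $H^3_{-4}=0$) such that $H^3_{-2}=a$, $H^3_0=b$. (3) (The family $W_5$.) Let $W_5$ be the set of closed subspaces $U$ with $z^2U\subset U$ of the form $U=\langle p_s\rangle_{s\in I}$, where $(p_s)$ is a canonical basis of some $W\in\Sigma_5$. Then $U\in W_5$ if and only if there is a (then unique) solution $H=(H^j_{-4},H^j_{-2},H^j_0)_{j\in I}$ of $(*)$ with $H^3_{-4}=0$ such that $U$ is spanned by the polynomials $p_j=z^j+H^j_{-4}z^4+H^j_{-2}z^2+H^j_0$, $j\in I$. For every such $H$ these $p_j$ are a basis of an infinite-dimensional commutative associative (non-unital) subalgebra $A_5\subset\mathbb C[z]$ with structure constants $(**)$, and the kernel of $\mathbb C[P_j:j\in I]\to\mathbb C[z]$, $P_j\mapsto p_j(z)$, is the ideal generated by the quadrics $P_jP_k-\sum_{l\in I}C_{jk}^lP_l$. (4) (Curves.) Let $\Gamma_5$ be the variety in the affine space with coordinates $p_j$, $H^j_{-4},H^j_{-2},H^j_0$ $(j\in I)$ defined by $H^3_{-4}=0$, by $(*)$ and by $p_jp_k=\sum_{l\in I}C_{jk}^lp_l$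 with $(**)$. With $a=H^3_{-2}$, $b=H^3_0$, the ideal generated by these equations contains $$p_5^3-p_3^5+2ap_3^3p_5-a^2p_3p_5^2+2bp_3^4-2abp_3^2p_5-b^2p_3^3$$ and $$\begin{aligned}&p_6^5-p_5^6+6ap_5p_6^4+14a^2p_5^2p_6^3+(6b+16a^3)p_5^3p_6^2+(16ab+9a^4)p_5^4p_6+(10a^2b+2a^5)p_5^5+2b^2p_6^4\\&+8ab^2p_5p_6^3+10a^2b^2p_5^2p_6^2+(14b^3+4a^3b^2)p_5^3p_6+20ab^3p_5^4+b^4p_6^3+2ab^4p_5p_6^2+8b^5p_5^3.\end{aligned}$$ For all $a,b\in\mathbb C$ these two polynomials, in the two variables $p_3,p_5$ and $p_5,p_6$ respectively, define irreducible rational plane curves (with function field isomorphic to $\mathbb C(t)$), of geometric genus $0$. -/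

import Mathlib

open scoped Polynomial

noncomputable section

namespace BirkhoffFive

/-! ### Formal Laurent series in `z⁻¹` and the Birkhoff strata of `Gr⁽²⁾`

`LaurentSeries ℂ` is used with the local parameter `z⁻¹`: the coefficient of `z ^ n` in `f`
is `f.coeff (-n)`, so that every series has finitely many positive powers of `z`. -/

/-- The element `z`. -/
def z : LaurentSeries ℂ := HahnSeries.single (-1) 1

/-- The coefficient of `z ^ n`. -/
def zcoeff (f : LaurentSeries ℂ) (n : ℤ) : ℂ := f.coeff (-n)

/-- `f` has order `n` in `z`: its leading term is a nonzero multiple of `z ^ n`. -/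
def HasOrder (f : LaurentSeries ℂ) (n : ℤ) : Prop :=
  zcoeff f n ≠ 0 ∧ ∀ m : ℤ, n < m → zcoeff f m = 0

/-- `S_m = {-m, -m + 2, …, m, m + 1, m + 2, …}`. -/
def stratumIndex (m : ℕ) : Set ℤ :=
  {s | (m : ℤ) ≤ s ∨ (-(m : ℤ) ≤ s ∧ s ≤ m ∧ Even (s + m))}

/-- `z² V ⊆ V`. -/
def SqInvariant (V : Submodule ℂ (LaurentSeries ℂ)) : Prop :=
  ∀ f ∈ V, z ^ 2 * f ∈ V

/-- `V · V ⊆ V`. -/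
def MulClosed (V : Submodule ℂ (LaurentSeries ℂ)) : Prop :=
  ∀ f ∈ V, ∀ g ∈ V, f * g ∈ V

/-- The stratum `Σ_m` of `Gr⁽²⁾`: the subspaces `W` with `z² W ⊆ W` whose nonzero elements have
exactly the orders in `S_m`. (As `S_m` is bounded below, such a `W` is the span of
any choice of elements `w_s ∈ W` of order `s`, `s ∈ S_m`.) -/
def stratum (m : ℕ) : Set (Submodule ℂ (LaurentSeries ℂ)) :=
  {W | SqInvariant W ∧ {n : ℤ | ∃ f ∈ W, HasOrder f n} = stratumIndex m}

/-- `(p_s)_{s ∈ S_m}` is a canonical basis of the point `W` of `Σ_m`: `p_s ∈ W` is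
`z ^ s` plus lower powers, and its nonnegative powers `z ^ i`, `i < s`, have `i ∉ S_m`.
(The negative powers are left free.) -/
def IsCanonicalBasis (m : ℕ) (W : Submodule ℂ (LaurentSeries ℂ)) (p : ℤ → LaurentSeries ℂ) :
    Prop :=
  ∀ s ∈ stratumIndex m, p s ∈ W ∧ zcoeff (p s) s = 1 ∧ (∀ n : ℤ, s < n → zcoeff (p s) n = 0) ∧
    ∀ i ∈ stratumIndex m, 0 ≤ i → i < s → zcoeff (p s) i = 0

/-- The orders `3, 5, 6, 7, …` as integers. -/
def closedOrders : Set ℤ := {n | n = 3 ∨ 5 ≤ n}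

/-- The family `W_5`: all subspaces `⟨p_3, p_5, p_6, …⟩` spanned by members of a canonical basis of
a point of `Σ_5` that are closed under multiplication and under `z²`. -/
def W5 : Set (Submodule ℂ (LaurentSeries ℂ)) :=
  {U | MulClosed U ∧ SqInvariant U ∧ ∃ W ∈ stratum 5, ∃ p : ℤ → LaurentSeries ℂ,
    IsCanonicalBasis 5 W p ∧ U = Submodule.span ℂ (p '' closedOrders)}

/-! ### The series `p_3, p_5, p_6, …`, the constraints and the structure constants -/

/-- The index set `3, 5, 6, 7, …`. -/
abbrev Idx : Type := {j : ℕ // j = 3 ∨ 5 ≤ j}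

def i3 : Idx := ⟨3, Or.inl rfl⟩
def i5 : Idx := ⟨5, Or.inr le_rfl⟩
def i6 : Idx := ⟨6, Or.inr (by norm_num)⟩

/-- The index `j + 2`. -/
def Idx.addTwo (j : Idx) : Idx := ⟨j.1 + 2, by have := j.2; omega⟩

/-- `p_j = z^j + H^j_{-4} z^4 + H^j_{-2} z^2 + H^j_0 + ∑_{k ≥ 1} H^j_k z^{-k}`, with
`H j k = H^j_k`. (For `j = 3` the convention is `H^3_{-4} = 0`.) -/
def series (H : Idx → ℤ → ℂ) (j : Idx) : LaurentSeries ℂ :=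
  z ^ (j : ℕ) + H j (-4) • z ^ 4 + H j (-2) • z ^ 2 + H j 0 • 1 +
    HahnSeries.ofPowerSeries ℤ ℂ (PowerSeries.mk fun k : ℕ => if k = 0 then 0 else H j k)

/-- The coefficients of the nonnegative powers: `evenPart H j s = H^j_{-2s}`, `s = 0, 1, 2`. -/
def evenPart (H : Idx → ℤ → ℂ) (j : Idx) (s : Fin 3) : ℂ := H j (-2 * ((s : ℕ) : ℤ))

/-- The quantities in `E j s = H^j_{-2s}` whose vanishing is the set of constraints. -/
def constraintSet {R : Type*} [CommRing R] (E : Idx → Fin 3 → R) : Set R :=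
  {E i3 2} ∪
  {E i5 0, E i5 1 - E i3 0, E i5 2 - E i3 1} ∪
  {E i6 0 + E i3 0 ^ 2, E i6 1 + 2 * E i3 0 * E i3 1, E i6 2 + E i3 1 ^ 2} ∪
  ⋃ j : Idx, {E j.addTwo 2 + E j 2 * E i6 2 - E j 1, E j.addTwo 1 + E j 2 * E i6 1 - E j 0,
    E j.addTwo 0 + E j 2 * E i6 0}

/-- The constraints on `E j s = H^j_{-2s}`. -/
def Constraints {R : Type*} [CommRing R] (E : Idx → Fin 3 → R) : Prop :=
  ∀ x ∈ constraintSet E, x = 0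

/-- The structure constants
`C_{jk}^l = δ_{j+k}^l + ∑_s H^j_{-2s} δ^l_{2s+k} + ∑_s H^k_{-2s} δ^l_{2s+j}
  + ∑_{s,r} H^j_{-2s} H^k_{-2r} δ^l_{2(r+s)}`. -/
def structConst {R : Type*} [CommRing R] (E : Idx → Fin 3 → R) (j k l : Idx) : R :=
  (if (l : ℕ) = j + k then 1 else 0) +
  (∑ s : Fin 3, if (l : ℕ) = 2 * s + k then E j s else 0) +
  (∑ s : Fin 3, if (l : ℕ) = 2 * s + j then E k s else 0) +
  ∑ s : Fin 3, ∑ r : Fin 3, if (l : ℕ) = 2 * (r + s) then E j s * E k r else 0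

/-- The polynomial `z^j + H^j_{-4} z^4 + H^j_{-2} z^2 + H^j_0`. -/
def basisPoly (E : Idx → Fin 3 → ℂ) (j : Idx) : ℂ[X] :=
  Polynomial.X ^ (j : ℕ) + ∑ s : Fin 3, Polynomial.C (E j s) * Polynomial.X ^ (2 * (s : ℕ))

/-- The inclusion of the polynomials in `z` in the Laurent series. -/
def polyToLaurent : ℂ[X] →ₐ[ℂ] LaurentSeries ℂ := Polynomial.aeval z

/-! ### The variety `Γ_5` -/

/-- Indices `l ≤ n`. -/
def idxUpTo (n : ℕ) : Finset Idx := (Finset.range (n + 1)).subtype (fun j => j = 3 ∨ 5 ≤ j)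

/-- `P_j P_k - ∑_l C_{jk}^l P_l`; the structure constants vanish for `l > j + k + 2`. -/
def quadric {R : Type*} [CommRing R] (E : Idx → Fin 3 → R) (P : Idx → R) (j k : Idx) : R :=
  P j * P k - ∑ l ∈ idxUpTo (j + k + 2), structConst E j k l * P l

/-- The affine coordinates `p_j` and `H^j_{-2s}`. -/
inductive Coord : Type
  | p (j : Idx)
  | h (j : Idx) (s : Fin 3)

def pVar (j : Idx) : MvPolynomial Coord ℂ := MvPolynomial.X (Coord.p j)

def hVar (j : Idx) (s : Fin 3) : MvPolynomial Coord ℂ := MvPolynomial.X (Coord.h j s)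

/-- The ideal of the equations of `Γ_5` in the affine space with coordinates `p_j`, `H^j_{-2s}`. -/
def gammaIdeal : Ideal (MvPolynomial Coord ℂ) :=
  Ideal.span (constraintSet hVar ∪ {q | ∃ j k : Idx, q = quadric hVar pVar j k})

/-- The fibre of that ideal over fixed values of the `H^j_{-2s}`. -/
def fibreIdeal (E : Idx → Fin 3 → ℂ) : Ideal (MvPolynomial Idx ℂ) :=
  Ideal.span {q | ∃ j k : Idx,
    q = quadric (fun i s => MvPolynomial.C (E i s)) MvPolynomial.X j k}

/-- The left side of the equation of the `(3,5)` curve; `a = H^3_{-2}`, `b = H^3_0`. -/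
def curve35 {R : Type*} [CommRing R] (a b p3 p5 : R) : R :=
  p5 ^ 3 - p3 ^ 5 + 2 * a * p3 ^ 3 * p5 - a ^ 2 * p3 * p5 ^ 2 + 2 * b * p3 ^ 4
    - 2 * b * a * p3 ^ 2 * p5 - b ^ 2 * p3 ^ 3

/-- The left side of the equation of the `(5,6)` curve; `a = H^3_{-2}`, `b = H^3_0`. -/
def curve56 {R : Type*} [CommRing R] (a b p5 p6 : R) : R :=
  p6 ^ 5 - p5 ^ 6 + 6 * a * p5 * p6 ^ 4 + 14 * a ^ 2 * p5 ^ 2 * p6 ^ 3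
    - (-6 * b - 16 * a ^ 3) * p5 ^ 3 * p6 ^ 2
    - (-16 * b * a - 9 * a ^ 4) * p5 ^ 4 * p6
    - (-10 * b * a ^ 2 - 2 * a ^ 5) * p5 ^ 5
    + 2 * b ^ 2 * p6 ^ 4 + 8 * b ^ 2 * a * p5 * p6 ^ 3 + 10 * a ^ 2 * b ^ 2 * p5 ^ 2 * p6 ^ 2
    - (-14 * b ^ 3 - 4 * a ^ 3 * b ^ 2) * p5 ^ 3 * p6
    + 20 * b ^ 3 * a * p5 ^ 4 + b ^ 4 * p6 ^ 3 + 2 * b ^ 4 * a * p5 * p6 ^ 2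
    + 8 * b ^ 5 * p5 ^ 3

/-! ### Plane curves and their genus -/

/-- The `(3,5)` curve as a polynomial in the two coordinates of the plane. -/
def plane35 (a b : ℂ) : MvPolynomial (Fin 2) ℂ :=
  curve35 (MvPolynomial.C a) (MvPolynomial.C b) (MvPolynomial.X 0) (MvPolynomial.X 1)

/-- The `(5,6)` curve as a polynomial in the two coordinates of the plane. -/
def plane56 (a b : ℂ) : MvPolynomial (Fin 2) ℂ :=
  curve56 (MvPolynomial.C a) (MvPolynomial.C b) (MvPolynomial.X 0) (MvPolynomial.X 1)

/-- The everywhere regular differentials of a function field `F` over `k`: those `ω ∈ Ω_{F/k}`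
that lie in `A · dA` for every valuation ring `A` of `F` containing `k`. -/
def regularDifferentials (k F : Type*) [Field k] [Field F] [Algebra k F] :
    Submodule k (Ω[F⁄k]) where
  carrier := {ω | ∀ A : ValuationSubring F, (∀ c : k, algebraMap k F c ∈ A) →
    ω ∈ Submodule.span A.toSubring (Set.range fun x : A => KaehlerDifferential.D k F (x : F))}
  add_mem' h₁ h₂ A hA := Submodule.add_mem _ (h₁ A hA) (h₂ A hA)
  zero_mem' A hA := Submodule.zero_mem _
  smul_mem' c ω h A hA := by
    have h2 := Submodule.smul_mem _ (⟨algebraMap k F c, hA c⟩ : A.toSubring) (h A hA)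
    have h3 : (⟨algebraMap k F c, hA c⟩ : A.toSubring) • ω = c • ω :=
      algebraMap_smul F c ω
    rwa [h3] at h2

/-- The coordinate ring of the plane curve `f = 0`. -/
abbrev CoordRing (f : MvPolynomial (Fin 2) ℂ) : Type :=
  MvPolynomial (Fin 2) ℂ ⧸ Ideal.span {f}

/-- The plane curve `f = 0` is integral and has geometric genus `g`: the space of regular
differentials of its function field (the global differentials on its smooth projective model)
has dimension `g`. -/
def HasGenus (f : MvPolynomial (Fin 2) ℂ) (g : ℕ) : Prop :=
  ∃ _ : IsDomain (CoordRing f),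
    Module.rank ℂ (regularDifferentials ℂ (FractionRing (CoordRing f))) = g

/-- The plane curve `f = 0` is irreducible and rational: its function field is `ℂ(t)`. -/
def IsRationalCurve (f : MvPolynomial (Fin 2) ℂ) : Prop :=
  Irreducible f ∧ Nonempty (FractionRing (CoordRing f) ≃ₐ[ℂ] RatFunc ℂ)

end BirkhoffFive

end

/-!
With `p = p_3 = z³ + h`, `h = a z² + b`, the constraints say exactly that `p_5 = z² p`, that
`p_6 = z⁶ - h² = (z³ - h) p`, and that `p_{j+2} = z² p_j - H^j_{-4} p_6`. Hence the span
`⟨p_3, p_5, p_6, …⟩` is `p · ℂ[z², z³]`, an ideal of the cuspidal ring; this gives closedness, and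
the structure constants are read off the coefficients of `z^l`, `l ∈ {3, 5, 6, 7, …}`, which
determine an element of the span. Conversely, `z²`-invariance excludes the
odd powers `z^n`, `n ≤ 1`, from the span; so `h = p_3 - z³` is even, and the odd part `2 z³ h` of
`p_3²` shows that `h` has no negative powers; then all the `p_j` are polynomials.

The quadrics allow one to multiply out every polynomial in the `P_j` to a combination of `1` and
the `P_j`, that is, to an element of the unitization of `A_5`, and that unitization embeds
in `ℂ[z]`: so the quadrics generate all relations, in particular those of the two plane curves.

The plane curves are parametrized by pairs of polynomials of coprime degrees `(3, 5)` and `(5, 6)`.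
Since `[ℂ(t) : ℂ(P)] = deg P`, the two polynomials generate `ℂ(t)`, and the equation of the curve,
being monic of degree `deg P` in `Q`, generates the relations between `P` and `Q`. Finally, a
regular differential of `ℂ(t)` is of the form `f(t) dt` and also of the form `g(1/t) d(1/t)` with
polynomials `f` and `g`, and these agree only if `f = 0`.
-/

noncomputable section

namespace BirkhoffFive

/-! ### The constraints -/

lemma Idx.addTwo_val (j : Idx) : (j.addTwo : ℕ) = j + 2 := rfl

lemma addTwo_i3 : i3.addTwo = i5 := rfl

lemma Idx.induction_addTwo {motive : Idx → Prop} (three : motive i3) (six : motive i6)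
    (addTwo : ∀ j, motive j → motive j.addTwo) : ∀ j, motive j
  | ⟨3, _⟩ => three
  | ⟨5, _⟩ => addTwo i3 three
  | ⟨6, _⟩ => six
  | ⟨n + 7, _⟩ => addTwo ⟨n + 5, Or.inr (by omega)⟩ (Idx.induction_addTwo three six addTwo _)

lemma Idx.ne_two_mul (l : Idx) (s : Fin 3) : (l : ℕ) ≠ 2 * (s : ℕ) := by
  have := l.2; omega

lemma eq_vec3_iff {α : Type*} {v : Fin 3 → α} {x y t : α} :
    v = ![x, y, t] ↔ v 0 = x ∧ v 1 = y ∧ v 2 = t := by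
  simp [funext_iff, Fin.forall_fin_succ]

lemma constraints_iff {R : Type*} [CommRing R] (E : Idx → Fin 3 → R) :
    Constraints E ↔ E i3 2 = 0 ∧
      E i6 = ![-E i3 0 ^ 2, -(2 * E i3 0 * E i3 1), -E i3 1 ^ 2] ∧
      ∀ j : Idx, E j.addTwo =
        ![-(E j 2 * E i6 0), E j 0 - E j 2 * E i6 1, E j 1 - E j 2 * E i6 2] := by
  change constraintSet E ⊆ {0} ↔ _
  simp only [constraintSet, Set.union_subset_iff, Set.iUnion_subset_iff, Set.insert_subset_iff,
    Set.singleton_subset_iff, Set.mem_singleton_iff, eq_vec3_iff]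
  constructor
  · rintro ⟨⟨⟨h3, -⟩, h60, h61, h62⟩, hj⟩
    exact ⟨h3, ⟨by linear_combination h60, by linear_combination h61, by linear_combination h62⟩,
      fun j => ⟨by linear_combination (hj j).2.2, by linear_combination (hj j).2.1,
        by linear_combination (hj j).1⟩⟩
  · rintro ⟨h3, ⟨h60, h61, h62⟩, hj⟩
    obtain ⟨h50, h51, h52⟩ := addTwo_i3 ▸ hj i3
    simp only [h3, zero_mul, neg_zero, sub_zero] at h50 h51 h52
    exact ⟨⟨⟨h3, h50, sub_eq_zero.2 h51, sub_eq_zero.2 h52⟩, by linear_combination h60,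
        by linear_combination h61, by linear_combination h62⟩,
      fun j => ⟨by linear_combination (hj j).2.2, by linear_combination (hj j).2.1,
        by linear_combination (hj j).1⟩⟩

lemma constraintSet_map {R S : Type*} [CommRing R] [CommRing S] (φ : R →+* S)
    (E : Idx → Fin 3 → R) :
    constraintSet (fun j s => φ (E j s)) = φ '' constraintSet E := by
  simp only [constraintSet, Set.image_union, Set.image_iUnion, Set.image_insert_eq,
    Set.image_singleton, map_add, map_sub, map_mul, map_pow, map_ofNat]

/-! ### The polynomials and the algebra they span -/

section Span

open Polynomial

variable {R : Type*} [CommRing R]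

/-- The polynomial `v₀ + v₁ z² + v₂ z⁴`; for `v = E j` it is the part of `p_j` below its leading
term. -/
def evenPoly (v : Fin 3 → R) : R[X] := ∑ s : Fin 3, C (v s) * X ^ (2 * (s : ℕ))

lemma evenPoly_eq (v : Fin 3 → R) : evenPoly v = C (v 2) * X ^ 4 + C (v 1) * X ^ 2 + C (v 0) := by
  simp only [evenPoly, Fin.sum_univ_three, Fin.val_zero, Fin.val_one, Fin.val_two, mul_zero,
    pow_zero, mul_one, Nat.reduceMul]
  ring

lemma coeff_evenPoly (v : Fin 3 → R) (s : Fin 3) : (evenPoly v).coeff (2 * s) = v s := by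
  have (r : Fin 3) : 2 * (s : ℕ) = 2 * (r : ℕ) ↔ s = r := by rw [Fin.ext_iff]; omega
  simp [evenPoly, coeff_X_pow, this]

lemma evenPoly_injective : Function.Injective (evenPoly : (Fin 3 → R) → R[X]) := fun v w h => by
  funext s
  rw [← coeff_evenPoly v, h, coeff_evenPoly]

/-- The polynomials `basisPoly` over an arbitrary commutative ring. -/
def genPoly (E : Idx → Fin 3 → R) (j : Idx) : R[X] := X ^ (j : ℕ) + evenPoly (E j)

lemma coeff_X_pow_add_evenPoly (v : Fin 3 → R) (j l : Idx) :
    (X ^ (j : ℕ) + evenPoly v).coeff l = if l = j then 1 else 0 := by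
  simp [evenPoly, coeff_X_pow, l.ne_two_mul, Subtype.ext_iff]

lemma coeff_genPoly (E : Idx → Fin 3 → R) (j l : Idx) :
    (genPoly E j).coeff l = if l = j then 1 else 0 :=
  coeff_X_pow_add_evenPoly (E j) j l

lemma coeff_genPoly_two_mul (E : Idx → Fin 3 → R) (j : Idx) (s : Fin 3) :
    (genPoly E j).coeff (2 * s) = E j s := by
  rw [genPoly, coeff_add, coeff_evenPoly, coeff_X_pow, if_neg (j.ne_two_mul s).symm, zero_add]

lemma natDegree_genPoly [Nontrivial R] {E : Idx → Fin 3 → R} (h3 : E i3 2 = 0) (j : Idx) :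
    (genPoly E j).natDegree = j := by
  suffices h : (evenPoly (E j)).natDegree < (X ^ (j : ℕ) : R[X]).natDegree by
    rw [genPoly, natDegree_add_eq_left_of_natDegree_lt h, natDegree_X_pow]
  rw [natDegree_X_pow, evenPoly_eq]
  obtain hj | hj := j.2
  · obtain rfl : j = i3 := Subtype.ext hj
    rw [h3, C_0, zero_mul, zero_add]
    have hle : (C (E i3 1) * X ^ 2 + C (E i3 0)).natDegree ≤ 2 := by compute_degree
    exact hle.trans_lt (by decide)
  · have hle : (C (E j 2) * X ^ 4 + C (E j 1) * X ^ 2 + C (E j 0)).natDegree ≤ 4 := by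
      compute_degree
    exact hle.trans_lt hj

lemma coeff_genPoly_mul (E : Idx → Fin 3 → R) (j k l : Idx) :
    (genPoly E j * genPoly E k).coeff l = structConst E j k l := by
  have expand : genPoly E j * genPoly E k = X ^ (j + k : ℕ) +
      ∑ s : Fin 3, C (E j s) * X ^ (2 * (s : ℕ) + k) +
      ∑ s : Fin 3, C (E k s) * X ^ (2 * (s : ℕ) + j) +
      ∑ s : Fin 3, ∑ r : Fin 3, C (E j s * E k r) * X ^ (2 * ((r : ℕ) + s)) := by
    simp only [genPoly, evenPoly, Fin.sum_univ_three, map_mul, pow_add, mul_add]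
    ring
  simp only [expand, structConst, coeff_add, finsetSum_coeff, coeff_C_mul, coeff_X_pow, mul_ite,
    mul_one, mul_zero]

lemma coeff_linearCombination_genPoly (E : Idx → Fin 3 → R) (c : Idx →₀ R) (l : Idx) :
    (Finsupp.linearCombination R (genPoly E) c).coeff l = c l := by
  classical
  simp [Finsupp.linearCombination_apply, Finsupp.sum, coeff_genPoly, eq_comm]

lemma linearIndependent_genPoly (E : Idx → Fin 3 → R) : LinearIndependent R (genPoly E) := by
  refine linearIndependent_iff.2 fun c hc => Finsupp.ext fun l => ?_
  rw [← coeff_linearCombination_genPoly E, hc, coeff_zero, Finsupp.zero_apply]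

/-- The span `⟨p_3, p_5, p_6, …⟩` of the polynomials `genPoly E`. -/
def polySpan (E : Idx → Fin 3 → R) : Submodule R R[X] := Submodule.span R (Set.range (genPoly E))

lemma genPoly_mem (E : Idx → Fin 3 → R) (j : Idx) : genPoly E j ∈ polySpan E :=
  Submodule.subset_span ⟨j, rfl⟩

lemma eq_of_mem_polySpan {E : Idx → Fin 3 → R} {f g : R[X]} (hf : f ∈ polySpan E)
    (hg : g ∈ polySpan E) (h : ∀ l : Idx, f.coeff l = g.coeff l) : f = g := by
  obtain ⟨c, rfl⟩ := Finsupp.mem_span_range_iff_exists_finsupp.1 hf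
  obtain ⟨d, rfl⟩ := Finsupp.mem_span_range_iff_exists_finsupp.1 hg
  have hcd : c = d := Finsupp.ext fun l => by
    simpa only [← Finsupp.linearCombination_apply, coeff_linearCombination_genPoly] using h l
  rw [hcd]

lemma eq_zero_of_C_mem_polySpan {E : Idx → Fin 3 → R} {c : R} (hc : C c ∈ polySpan E) : c = 0 := by
  have hl (l : Idx) : (l : ℕ) ≠ 0 := by have := l.2; omega
  exact C_eq_zero.1 <|
    eq_of_mem_polySpan hc (zero_mem _) fun l => by rw [coeff_C_of_ne_zero (hl l), coeff_zero]

lemma genPoly_i3_eq_iff (E : Idx → Fin 3 → R) :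
    genPoly E i3 = X ^ 3 + (C (E i3 1) * X ^ 2 + C (E i3 0)) ↔ E i3 2 = 0 := by
  have h : C (E i3 1) * X ^ 2 + C (E i3 0) = evenPoly ![E i3 0, E i3 1, 0] := by
    simp [evenPoly_eq]
  rw [h, genPoly, i3, add_right_inj, evenPoly_injective.eq_iff, eq_vec3_iff]
  exact ⟨fun h => h.2.2, fun h => ⟨rfl, rfl, h⟩⟩

lemma X_pow_six_sub_sq (a b : R) :
    X ^ 6 - (C a * X ^ 2 + C b) ^ 2 = X ^ (i6 : ℕ) + evenPoly ![-b ^ 2, -(2 * b * a), -a ^ 2] := by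
  simp only [evenPoly_eq, i6, map_neg, map_mul, map_pow, map_ofNat, Matrix.cons_val]
  ring

theorem constraints_iff_genPoly (E : Idx → Fin 3 → R) :
    Constraints E ↔ genPoly E i3 = X ^ 3 + (C (E i3 1) * X ^ 2 + C (E i3 0)) ∧
      genPoly E i6 = X ^ 6 - (C (E i3 1) * X ^ 2 + C (E i3 0)) ^ 2 ∧
      ∀ j : Idx, genPoly E j.addTwo = X ^ 2 * genPoly E j - C (E j 2) * genPoly E i6 := by
  have genPoly_eq_iff (j : Idx) (v : Fin 3 → R) :
      E j = v ↔ genPoly E j = X ^ (j : ℕ) + evenPoly v :=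
    evenPoly_injective.eq_iff.symm.trans (add_right_inj _).symm
  rw [constraints_iff]
  refine and_congr (genPoly_i3_eq_iff E).symm (and_congr ?_ (forall_congr' fun j => ?_))
  · rw [X_pow_six_sub_sq, genPoly_eq_iff]
  · rw [genPoly_eq_iff]
    refine Eq.congr_right ?_
    simp only [evenPoly_eq, genPoly, i6, Idx.addTwo_val, map_neg, map_sub, map_mul,
      Matrix.cons_val]
    ring

end Span

section Algebra

open Polynomial

variable {R : Type*} [CommRing R] {E : Idx → Fin 3 → R}

namespace Constraints

lemma genPoly_i5 (hE : Constraints E) : genPoly E i5 = X ^ 2 * genPoly E i3 := by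
  rw [← addTwo_i3, ((constraints_iff_genPoly E).1 hE).2.2 i3, ((constraints_iff E).1 hE).1, C_0,
    zero_mul, sub_zero]

lemma sq_mul_genPoly (hE : Constraints E) (j : Idx) :
    X ^ 2 * genPoly E j = genPoly E j.addTwo + C (E j 2) * genPoly E i6 := by
  rw [((constraints_iff_genPoly E).1 hE).2.2 j, sub_add_cancel]

lemma sq_mul_mem (hE : Constraints E) {f : R[X]} (hf : f ∈ polySpan E) :
    X ^ 2 * f ∈ polySpan E := by
  refine (Submodule.span_le (p := (polySpan E).comap (LinearMap.mulLeft R (X ^ 2)))).2 ?_ hf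
  rintro _ ⟨j, rfl⟩
  rw [SetLike.mem_coe, Submodule.mem_comap, LinearMap.mulLeft_apply, hE.sq_mul_genPoly, C_mul']
  exact add_mem (genPoly_mem E _) (Submodule.smul_mem _ _ (genPoly_mem E _))

end Constraints

/-- The ring `R[z², z³]` of the polynomials without a term in `z`. -/
def cuspidalRing (R : Type*) [CommRing R] : Subalgebra R R[X] where
  carrier := {u | u.coeff 1 = 0}
  mul_mem' {u v} (hu : u.coeff 1 = 0) (hv : v.coeff 1 = 0) := by
    simp [mul_coeff_one, hu, hv]
  add_mem' {u v} (hu : u.coeff 1 = 0) (hv : v.coeff 1 = 0) := by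
    simp [hu, hv]
  algebraMap_mem' r := coeff_C_of_ne_zero one_ne_zero

lemma mem_cuspidalRing {u : R[X]} : u ∈ cuspidalRing R ↔ u.coeff 1 = 0 := Iff.rfl

lemma X_pow_mem_cuspidalRing {n : ℕ} (hn : n ≠ 1) : (X ^ n : R[X]) ∈ cuspidalRing R := by
  rw [mem_cuspidalRing, coeff_X_pow, if_neg hn.symm]

lemma genPoly_mem_cuspidalRing (E : Idx → Fin 3 → R) (j : Idx) : genPoly E j ∈ cuspidalRing R :=
  add_mem (X_pow_mem_cuspidalRing (by have := j.2; omega)) <|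
    sum_mem fun s _ => mul_mem (Subalgebra.algebraMap_mem _ (E j s))
      (X_pow_mem_cuspidalRing (by omega))

lemma coeff_genPoly_one (E : Idx → Fin 3 → R) (j : Idx) : (genPoly E j).coeff 1 = 0 :=
  genPoly_mem_cuspidalRing E j

namespace Constraints

lemma exists_genPoly_eq_mul (hE : Constraints E) (j : Idx) :
    ∃ u ∈ cuspidalRing R, genPoly E j = genPoly E i3 * u := by
  obtain ⟨h3, h6, hj⟩ := (constraints_iff_genPoly E).1 hE
  have hC (c : R) : C c ∈ cuspidalRing R := Subalgebra.algebraMap_mem _ c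
  have hX {n : ℕ} (hn : n ≠ 1) := X_pow_mem_cuspidalRing (R := R) hn
  obtain ⟨w, hw, h6w⟩ : ∃ w ∈ cuspidalRing R, genPoly E i6 = genPoly E i3 * w := by
    refine ⟨X ^ 3 - (C (E i3 1) * X ^ 2 + C (E i3 0)), ?_, by rw [h6, h3]; ring⟩
    exact sub_mem (hX (by simp)) (add_mem (mul_mem (hC _) (hX (by simp))) (hC _))
  induction j using Idx.induction_addTwo with
  | three => exact ⟨1, one_mem _, (mul_one _).symm⟩
  | six => exact ⟨w, hw, h6w⟩
  | addTwo j ih =>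
    obtain ⟨u, hu, hju⟩ := ih
    refine ⟨X ^ 2 * u - C (E j 2) * w, ?_, by rw [hj, hju, h6w]; ring⟩
    exact sub_mem (mul_mem (hX (by simp)) hu) (mul_mem (hC _) hw)

lemma genPoly_i3_mul_X_pow_mem (hE : Constraints E) :
    ∀ n : ℕ, n ≠ 1 → genPoly E i3 * X ^ n ∈ polySpan E
  | 0, _ => by simpa using genPoly_mem E i3
  | 1, h => (h rfl).elim
  | 2, _ => by
    rw [mul_comm]
    exact hE.sq_mul_mem (genPoly_mem E i3)
  | 3, _ => by
    have h3 : genPoly E i3 * X ^ 3 = genPoly E i6 + E i3 1 • genPoly E i5 +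
        E i3 0 • genPoly E i3 := by
      obtain ⟨h3, h6, -⟩ := (constraints_iff_genPoly E).1 hE
      rw [hE.genPoly_i5, smul_eq_C_mul, smul_eq_C_mul, h6, h3]
      ring
    rw [h3]
    exact add_mem (add_mem (genPoly_mem E _) (Submodule.smul_mem _ _ (genPoly_mem E _)))
      (Submodule.smul_mem _ _ (genPoly_mem E _))
  | n + 4, _ => by
    rw [show n + 4 = n + 2 + 2 from rfl, pow_add, ← mul_assoc, mul_comm]
    exact hE.sq_mul_mem (hE.genPoly_i3_mul_X_pow_mem (n + 2) (by omega))

theorem mem_polySpan_iff (hE : Constraints E) {f : R[X]} :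
    f ∈ polySpan E ↔ ∃ u ∈ cuspidalRing R, f = genPoly E i3 * u := by
  constructor
  · intro hf
    induction hf using Submodule.span_induction with
    | mem f hf =>
      obtain ⟨j, rfl⟩ := hf
      exact hE.exists_genPoly_eq_mul j
    | zero => exact ⟨0, zero_mem _, (mul_zero _).symm⟩
    | add f g _ _ hf hg =>
      obtain ⟨⟨u, hu, rfl⟩, v, hv, rfl⟩ := hf, hg
      exact ⟨u + v, add_mem hu hv, (mul_add _ _ _).symm⟩
    | smul c f _ hf =>
      obtain ⟨u, hu, rfl⟩ := hf
      exact ⟨c • u, Subalgebra.smul_mem _ hu c, (mul_smul_comm _ _ _).symm⟩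
  · rintro ⟨u, hu, rfl⟩
    rw [u.as_sum_support_C_mul_X_pow, Finset.mul_sum]
    refine sum_mem fun n hn => ?_
    rw [mul_left_comm, C_mul']
    refine Submodule.smul_mem _ _ (hE.genPoly_i3_mul_X_pow_mem n ?_)
    rintro rfl
    exact mem_support_iff.1 hn hu

lemma mul_mem_polySpan (hE : Constraints E) {f g : R[X]} (hf : f ∈ polySpan E)
    (hg : g ∈ polySpan E) : f * g ∈ polySpan E := by
  rw [hE.mem_polySpan_iff] at *
  obtain ⟨⟨u, hu, rfl⟩, v, hv, rfl⟩ := hf, hg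
  exact ⟨u * (genPoly E i3 * v), mul_mem hu (mul_mem (genPoly_mem_cuspidalRing E i3) hv),
    mul_assoc _ _ _⟩

end Constraints

lemma structConst_eq_zero (E : Idx → Fin 3 → R) {j k l : Idx} (h : (j + k + 2 : ℕ) < l) :
    structConst E j k l = 0 := by
  have hj := j.2
  have hk := k.2
  have h1 : (l : ℕ) ≠ j + k := by omega
  have h2 (s : Fin 3) : (l : ℕ) ≠ 2 * s + k := by omega
  have h3 (s : Fin 3) : (l : ℕ) ≠ 2 * s + j := by omega
  have h4 (s r : Fin 3) : (l : ℕ) ≠ 2 * (r + s) := by omega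
  simp [structConst, h1, h2, h3, h4]

lemma mem_idxUpTo {n : ℕ} {l : Idx} : l ∈ idxUpTo n ↔ (l : ℕ) ≤ n := by
  simp [idxUpTo]

theorem genPoly_mul_eq_sum (hE : Constraints E) (j k : Idx) :
    genPoly E j * genPoly E k =
      ∑ l ∈ idxUpTo (j + k + 2), structConst E j k l • genPoly E l := by
  refine eq_of_mem_polySpan (hE.mul_mem_polySpan (genPoly_mem E j) (genPoly_mem E k))
    (sum_mem fun l _ => Submodule.smul_mem _ _ (genPoly_mem E l)) fun l => ?_
  simp only [coeff_genPoly_mul, finsetSum_coeff, coeff_smul, coeff_genPoly, smul_eq_mul, mul_ite,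
    mul_one, mul_zero, Finset.sum_ite_eq, mem_idxUpTo]
  split_ifs with h
  · rfl
  · exact structConst_eq_zero E (not_le.1 h)

/-- The algebra `A_5 = ⟨p_3, p_5, p_6, …⟩`. -/
def polyAlgebra (hE : Constraints E) : NonUnitalSubalgebra R R[X] :=
  (polySpan E).toNonUnitalSubalgebra fun _ _ => hE.mul_mem_polySpan

/-- The basis `p_3, p_5, p_6, …` of `A_5`. -/
def polyBasis (hE : Constraints E) : Module.Basis Idx R (polyAlgebra hE) :=
  Module.Basis.span (linearIndependent_genPoly E)

lemma coe_polyBasis (hE : Constraints E) (j : Idx) : (polyBasis hE j : R[X]) = genPoly E j :=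
  congrArg Subtype.val (Module.Basis.span_apply (linearIndependent_genPoly E) j)

lemma polyBasis_repr (hE : Constraints E) (u : polyAlgebra hE) (l : Idx) :
    (polyBasis hE).repr u l = (u : R[X]).coeff l := by
  have hu : Finsupp.linearCombination R (genPoly E) ((polyBasis hE).repr u) = u := by
    conv_rhs => rw [← (polyBasis hE).linearCombination_repr u]
    simp only [Finsupp.linearCombination_apply, Finsupp.sum, AddSubmonoidClass.coe_finsetSum,
      NonUnitalSubalgebra.coe_smul, coe_polyBasis]
  rw [← coeff_linearCombination_genPoly E, hu]

lemma polyBasis_mul (hE : Constraints E) (j k : Idx) :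
    polyBasis hE j * polyBasis hE k =
      ∑ l ∈ idxUpTo (j + k + 2), structConst E j k l • polyBasis hE l := by
  refine Subtype.ext ?_
  simpa only [NonUnitalSubalgebra.coe_mul, AddSubmonoidClass.coe_finsetSum,
    NonUnitalSubalgebra.coe_smul, coe_polyBasis] using genPoly_mul_eq_sum hE j k

instance : Infinite Idx :=
  Infinite.of_injective (fun n : ℕ => (⟨n + 5, Or.inr (by omega)⟩ : Idx)) fun m n h => by
    simpa using congrArg Subtype.val h

theorem exists_polyAlgebra [Nontrivial R] (hE : Constraints E) :
    ∃ (A : NonUnitalSubalgebra R R[X]) (β : Module.Basis Idx R A),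
      (∀ j, (β j : R[X]) = genPoly E j) ∧ ¬ Module.Finite R A ∧
        ∀ j k l, β.repr (β j * β k) l = structConst E j k l := by
  refine ⟨polyAlgebra hE, polyBasis hE, coe_polyBasis hE, fun h => ?_, fun j k l => ?_⟩
  · have := Module.Finite.finite_basis (polyBasis hE)
    exact not_finite Idx
  · rw [polyBasis_repr, NonUnitalSubalgebra.coe_mul, coe_polyBasis, coe_polyBasis,
      coeff_genPoly_mul]

lemma map_structConst {S F : Type*} [CommRing S] [FunLike F R S] [RingHomClass F R S]
    (φ : F) (E : Idx → Fin 3 → R) (j k l : Idx) :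
    φ (structConst E j k l) = structConst (fun i s => φ (E i s)) j k l := by
  simp only [structConst, map_add, map_sum, map_mul, apply_ite φ, map_zero, map_one]

lemma map_quadric {S F : Type*} [CommRing S] [FunLike F R S] [RingHomClass F R S]
    (φ : F) (E : Idx → Fin 3 → R) (P : Idx → R) (j k : Idx) :
    φ (quadric E P j k) = quadric (fun i s => φ (E i s)) (fun i => φ (P i)) j k := by
  simp only [quadric, map_sub, map_mul, map_sum, map_structConst]

lemma quadric_genPoly (hE : Constraints E) (j k : Idx) :
    quadric (fun i s => C (E i s)) (genPoly E) j k = 0 := by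
  simp only [quadric, genPoly_mul_eq_sum hE, smul_eq_C_mul, map_structConst, sub_self]

/-! ### Relations between the `p_j` -/

section Relations

variable {S : Type*} [CommRing S] [Algebra R S] {P : Idx → S}

/-- The homomorphism `A_5 → S`, `p_j ↦ P_j`, for elements `P_j` that multiply with the structure
constants of `A_5`. -/
def polyAlgebraLift (hE : Constraints E)
    (hP : ∀ j k, quadric (fun i s => algebraMap R S (E i s)) P j k = 0) :
    polyAlgebra hE →ₙₐ[R] S where
  __ := (polyBasis hE).constr R P
  map_zero' := map_zero ((polyBasis hE).constr R P)
  map_mul' x y := by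
    let L := (polyBasis hE).constr R P
    suffices h : (LinearMap.mul R (polyAlgebra hE)).compr₂ L = (LinearMap.mul R S).compl₁₂ L L from
      LinearMap.congr_fun₂ h x y
    refine (polyBasis hE).ext fun j => (polyBasis hE).ext fun k => ?_
    simp only [LinearMap.compr₂_apply, LinearMap.compl₁₂_apply, LinearMap.mul_apply', L,
      polyBasis_mul, map_sum, map_smul, Module.Basis.constr_basis, Algebra.smul_def,
      map_structConst]
    exact (sub_eq_zero.1 (hP j k)).symm

lemma polyAlgebraLift_polyBasis (hE : Constraints E)
    (hP : ∀ j k, quadric (fun i s => algebraMap R S (E i s)) P j k = 0) (j : Idx) :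
    polyAlgebraLift hE hP (polyBasis hE j) = P j :=
  (polyBasis hE).constr_basis R P j

lemma unitization_polyAlgebra_injective (hE : Constraints E) :
    Function.Injective (NonUnitalSubalgebra.unitization (polyAlgebra hE)) :=
  AlgHomClass.unitization_injective' (polyAlgebra hE)
    (fun _ hr hmem => hr (eq_zero_of_C_mem_polySpan hmem)) _
    fun _ => by rw [NonUnitalSubalgebra.unitization_apply]; simp

/-- The algebra obtained from `A_5` by adjoining a unit embeds in `R[X]` and maps to every algebra
containing elements with the multiplication table of `A_5`. -/
theorem aeval_eq_zero_of_aeval_genPoly_eq_zero (hE : Constraints E)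
    (hP : ∀ j k, quadric (fun i s => algebraMap R S (E i s)) P j k = 0)
    {f : MvPolynomial Idx R} (hf : MvPolynomial.aeval (genPoly E) f = 0) :
    MvPolynomial.aeval P f = 0 := by
  let β (j : Idx) : Unitization R (polyAlgebra hE) := ↑(polyBasis hE j)
  have hβ : MvPolynomial.aeval β f = 0 := by
    refine unitization_polyAlgebra_injective hE ?_
    rw [map_zero, ← hf, MvPolynomial.comp_aeval_apply]
    simp [β, coe_polyBasis]
  have hPβ := congrArg (Unitization.lift (polyAlgebraLift hE hP)) hβ
  rw [map_zero, MvPolynomial.comp_aeval_apply] at hPβ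
  simpa [β, polyAlgebraLift_polyBasis] using hPβ

theorem ker_aeval_genPoly (hE : Constraints E) :
    RingHom.ker (MvPolynomial.aeval (R := R) (genPoly E)) = Ideal.span {q | ∃ j k : Idx,
      q = quadric (fun i s => MvPolynomial.C (E i s)) MvPolynomial.X j k} := by
  refine le_antisymm (fun f hf => ?_) (Ideal.span_le.2 ?_)
  · set I := Ideal.span {q | ∃ j k : Idx,
      q = quadric (fun i s => MvPolynomial.C (E i s)) MvPolynomial.X j k}
    let P (i : Idx) : MvPolynomial Idx R ⧸ I := Ideal.Quotient.mk I (MvPolynomial.X i)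
    have hP (j k : Idx) : quadric (fun i s => algebraMap R _ (E i s)) P j k = 0 :=
      (map_quadric (Ideal.Quotient.mk I) _ _ j k).symm.trans
        (Ideal.Quotient.eq_zero_iff_mem.2 (Ideal.subset_span ⟨j, k, rfl⟩))
    have hmk : MvPolynomial.aeval P = Ideal.Quotient.mkₐ R I :=
      MvPolynomial.algHom_ext (by simp [P])
    rw [← Ideal.Quotient.eq_zero_iff_mem, ← Ideal.Quotient.mkₐ_eq_mk R, ← hmk]
    exact aeval_eq_zero_of_aeval_genPoly_eq_zero hE hP hf
  · rintro _ ⟨j, k, rfl⟩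
    rw [SetLike.mem_coe, RingHom.mem_ker, map_quadric, ← quadric_genPoly hE j k]
    simp only [MvPolynomial.aeval_C, MvPolynomial.aeval_X, algebraMap_eq]

end Relations

/-! ### The curves in the ideal of `Γ_5` -/

section Curves

lemma map_curve35 {S F : Type*} [CommRing S] [FunLike F R S] [RingHomClass F R S]
    (φ : F) (a b x y : R) :
    φ (curve35 a b x y) = curve35 (φ a) (φ b) (φ x) (φ y) := by
  simp only [curve35, map_add, map_sub, map_mul, map_pow, map_ofNat]

lemma map_curve56 {S F : Type*} [CommRing S] [FunLike F R S] [RingHomClass F R S]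
    (φ : F) (a b x y : R) :
    φ (curve56 a b x y) = curve56 (φ a) (φ b) (φ x) (φ y) := by
  simp only [curve56, map_add, map_sub, map_mul, map_pow, map_neg, map_ofNat]

lemma curve35_genPoly (hE : Constraints E) :
    curve35 (C (E i3 1)) (C (E i3 0)) (genPoly E i3) (genPoly E i5) = 0 := by
  rw [hE.genPoly_i5, ((constraints_iff_genPoly E).1 hE).1, curve35]
  ring

lemma curve56_genPoly (hE : Constraints E) :
    curve56 (C (E i3 1)) (C (E i3 0)) (genPoly E i5) (genPoly E i6) = 0 := by
  obtain ⟨h3, h6, -⟩ := (constraints_iff_genPoly E).1 hE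
  rw [hE.genPoly_i5, h6, h3, curve56]
  ring

variable {P : Idx → R}

theorem curve35_eq_zero (hE : Constraints E) (hP : ∀ j k, quadric E P j k = 0) :
    curve35 (E i3 1) (E i3 0) (P i3) (P i5) = 0 := by
  have h := aeval_eq_zero_of_aeval_genPoly_eq_zero hE (S := R) (P := P) hP
    (f := curve35 (.C (E i3 1)) (.C (E i3 0)) (.X i3) (.X i5)) ?_
  · simpa only [map_curve35, MvPolynomial.aeval_C, MvPolynomial.aeval_X, Algebra.algebraMap_self,
      RingHom.id_apply] using h
  · simpa only [map_curve35, MvPolynomial.aeval_C, MvPolynomial.aeval_X, algebraMap_eq]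
      using curve35_genPoly hE

theorem curve56_eq_zero (hE : Constraints E) (hP : ∀ j k, quadric E P j k = 0) :
    curve56 (E i3 1) (E i3 0) (P i5) (P i6) = 0 := by
  have h := aeval_eq_zero_of_aeval_genPoly_eq_zero hE (S := R) (P := P) hP
    (f := curve56 (.C (E i3 1)) (.C (E i3 0)) (.X i5) (.X i6)) ?_
  · simpa only [map_curve56, MvPolynomial.aeval_C, MvPolynomial.aeval_X, Algebra.algebraMap_self,
      RingHom.id_apply] using h
  · simpa only [map_curve56, MvPolynomial.aeval_C, MvPolynomial.aeval_X, algebraMap_eq]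
      using curve56_genPoly hE

variable {I : Ideal R}

lemma constraints_mk (hE : constraintSet E ⊆ I) :
    Constraints fun j s => Ideal.Quotient.mk I (E j s) := by
  rw [Constraints, constraintSet_map, Set.forall_mem_image]
  exact fun x hx => Ideal.Quotient.eq_zero_iff_mem.2 (hE hx)

lemma quadric_mk (hP : ∀ j k, quadric E P j k ∈ I) (j k : Idx) :
    quadric (fun i s => Ideal.Quotient.mk I (E i s)) (fun i => Ideal.Quotient.mk I (P i)) j k =
      0 :=
  (map_quadric (Ideal.Quotient.mk I) E P j k).symm.trans (Ideal.Quotient.eq_zero_iff_mem.2 (hP j k))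

theorem curve35_mem (hE : constraintSet E ⊆ I) (hP : ∀ j k, quadric E P j k ∈ I) :
    curve35 (E i3 1) (E i3 0) (P i3) (P i5) ∈ I := by
  have h := curve35_eq_zero (constraints_mk hE) (quadric_mk hP)
  rwa [← I.mk_ker, RingHom.mem_ker, map_curve35]

theorem curve56_mem (hE : constraintSet E ⊆ I) (hP : ∀ j k, quadric E P j k ∈ I) :
    curve56 (E i3 1) (E i3 0) (P i5) (P i6) ∈ I := by
  have h := curve56_eq_zero (constraints_mk hE) (quadric_mk hP)
  rwa [← I.mk_ker, RingHom.mem_ker, map_curve56]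

lemma constraintSet_subset_gammaIdeal : constraintSet hVar ⊆ gammaIdeal :=
  fun _ hx => Ideal.subset_span (Or.inl hx)

lemma quadric_mem_gammaIdeal (j k : Idx) : quadric hVar pVar j k ∈ gammaIdeal :=
  Ideal.subset_span (Or.inr ⟨j, k, rfl⟩)

theorem curve35_mem_gammaIdeal :
    curve35 (hVar i3 1) (hVar i3 0) (pVar i3) (pVar i5) ∈ gammaIdeal :=
  curve35_mem constraintSet_subset_gammaIdeal quadric_mem_gammaIdeal

theorem curve56_mem_gammaIdeal :
    curve56 (hVar i3 1) (hVar i3 0) (pVar i5) (pVar i6) ∈ gammaIdeal :=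
  curve56_mem constraintSet_subset_gammaIdeal quadric_mem_gammaIdeal

end Curves

/-! ### Solutions of the constraints -/

section Solutions

/-- Multiplication by `z²` modulo `z⁶ - (a z² + b)²`, on the coefficients of `1, z², z⁴`. -/
def sqStep (a b : R) (v : Fin 3 → R) : Fin 3 → R :=
  ![v 2 * b ^ 2, v 0 + v 2 * (2 * b * a), v 1 + v 2 * a ^ 2]

/-- The solution of the constraints with `H^3_{-2} = a` and `H^3_0 = b`. -/
def solution (a b : R) (j : Idx) : Fin 3 → R :=
  if Odd (j : ℕ) then (sqStep a b)^[((j : ℕ) - 3) / 2] ![b, a, 0]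
  else (sqStep a b)^[((j : ℕ) - 6) / 2] ![-b ^ 2, -(2 * b * a), -a ^ 2]

lemma solution_i3 (a b : R) : solution a b i3 = ![b, a, 0] :=
  if_pos (by decide)

lemma solution_i6 (a b : R) : solution a b i6 = ![-b ^ 2, -(2 * b * a), -a ^ 2] :=
  if_neg (by decide)

lemma solution_addTwo (a b : R) (j : Idx) :
    solution a b j.addTwo = sqStep a b (solution a b j) := by
  have hodd : Odd (j + 2 : ℕ) ↔ Odd (j : ℕ) := by simp [Nat.odd_add]
  have hj := j.2
  simp only [solution, Idx.addTwo_val, hodd]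
  split_ifs with h
  · rw [show ((j : ℕ) + 2 - 3) / 2 = ((j : ℕ) - 3) / 2 + 1 by omega,
      Function.iterate_succ_apply']
  · have : (j : ℕ) % 2 = 0 := Nat.not_odd_iff.1 h
    rw [show ((j : ℕ) + 2 - 6) / 2 = ((j : ℕ) - 6) / 2 + 1 by omega,
      Function.iterate_succ_apply']

lemma constraints_solution (a b : R) : Constraints (solution a b) := by
  rw [constraints_iff]
  refine ⟨?_, ?_, fun j => ?_⟩
  · simp [solution_i3]
  · simp [solution_i3, solution_i6]
  · simp [solution_addTwo, sqStep, solution_i6]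

lemma Constraints.ext {E E' : Idx → Fin 3 → R} (hE : Constraints E) (hE' : Constraints E')
    (h1 : E i3 1 = E' i3 1) (h0 : E i3 0 = E' i3 0) : E = E' := by
  obtain ⟨h3, h6, hj⟩ := (constraints_iff E).1 hE
  obtain ⟨h3', h6', hj'⟩ := (constraints_iff E').1 hE'
  have h66 : E i6 = E' i6 := by rw [h6, h6', h0, h1]
  funext j
  induction j using Idx.induction_addTwo with
  | three =>
    exact (eq_vec3_iff.2 ⟨h0, h1, h3⟩).trans (eq_vec3_iff.2 ⟨rfl, rfl, h3'⟩).symm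
  | six => exact h66
  | addTwo j ih => rw [hj, hj', ih, h66]

theorem existsUnique_constraints (a b : R) :
    ∃! E : Idx → Fin 3 → R, Constraints E ∧ E i3 1 = a ∧ E i3 0 = b := by
  have h1 : solution a b i3 1 = a := by simp [solution_i3]
  have h0 : solution a b i3 0 = b := by simp [solution_i3]
  refine ⟨solution a b, ⟨constraints_solution a b, h1, h0⟩, fun E ⟨hE, hE1, hE0⟩ => ?_⟩
  exact hE.ext (constraints_solution a b) (hE1.trans h1.symm) (hE0.trans h0.symm)

end Solutions

end Algebra

/-! ### Coefficients of Laurent series -/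

section Laurent

-- The module structure on series used here is the coefficientwise one; it is not definitionally
-- that of the algebra structure of `LaurentSeries ℂ`.
instance : IsScalarTower ℂ (LaurentSeries ℂ) (LaurentSeries ℂ) where
  smul_assoc c f g := by
    simp only [smul_eq_mul, ← HahnSeries.C_mul_eq_smul, mul_assoc]

instance : SMulCommClass ℂ (LaurentSeries ℂ) (LaurentSeries ℂ) where
  smul_comm c f g := by
    simp only [smul_eq_mul, ← HahnSeries.C_mul_eq_smul, mul_left_comm]

lemma algebraMap_mul_eq_smul (c : ℂ) (f : LaurentSeries ℂ) :
    algebraMap ℂ (LaurentSeries ℂ) c * f = c • f := by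
  rw [← HahnSeries.C_mul_eq_smul, HahnSeries.algebraMap_apply', ← PowerSeries.C_eq_algebraMap,
    HahnSeries.ofPowerSeries_C]

lemma zcoeff_ext {f g : LaurentSeries ℂ} (h : ∀ n, zcoeff f n = zcoeff g n) : f = g :=
  HahnSeries.ext <| funext fun n => by simpa only [zcoeff, neg_neg] using h (-n)

lemma zcoeff_zero (n : ℤ) : zcoeff 0 n = 0 := rfl

lemma zcoeff_add (f g : LaurentSeries ℂ) (n : ℤ) :
    zcoeff (f + g) n = zcoeff f n + zcoeff g n := rfl

lemma zcoeff_sub (f g : LaurentSeries ℂ) (n : ℤ) :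
    zcoeff (f - g) n = zcoeff f n - zcoeff g n := rfl

lemma zcoeff_smul (c : ℂ) (f : LaurentSeries ℂ) (n : ℤ) :
    zcoeff (c • f) n = c * zcoeff f n := rfl

lemma zcoeff_sum {ι : Type*} (s : Finset ι) (f : ι → LaurentSeries ℂ) (n : ℤ) :
    zcoeff (∑ i ∈ s, f i) n = ∑ i ∈ s, zcoeff (f i) n :=
  HahnSeries.coeff_sum (-n)

lemma zcoeff_mul_eq_zero {f g : LaurentSeries ℂ} {n : ℤ}
    (h : ∀ i j, i + j = n → zcoeff f i = 0 ∨ zcoeff g j = 0) : zcoeff (f * g) n = 0 := by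
  rw [zcoeff, HahnSeries.coeff_mul]
  refine Finset.sum_eq_zero fun ij hij => mul_eq_zero.2 ?_
  have hsum : -ij.1 + -ij.2 = n := by
    rw [← neg_add, (Finset.mem_antidiagonal.1 hij).2.2, neg_neg]
  simpa only [zcoeff, neg_neg] using h _ _ hsum

lemma z_pow (k : ℕ) : z ^ k = HahnSeries.single (-(k : ℤ)) 1 := by
  simp [z, HahnSeries.single_pow]

lemma zcoeff_z_pow_mul (k : ℕ) (f : LaurentSeries ℂ) (n : ℤ) :
    zcoeff (z ^ k * f) n = zcoeff f (n - k) := by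
  rw [z_pow, zcoeff, HahnSeries.coeff_single_mul, one_mul, zcoeff]
  congr 1
  ring

/-! ### Polynomials as Laurent series -/

lemma polyToLaurent_X : polyToLaurent Polynomial.X = z := Polynomial.aeval_X z

/-- `polyToLaurent` as a linear map for the coefficientwise scalar multiplication of series. -/
def polyToLaurentₗ : ℂ[X] →ₗ[ℂ] LaurentSeries ℂ where
  toFun := polyToLaurent
  map_add' := map_add polyToLaurent
  map_smul' c f := by
    rw [Polynomial.smul_eq_C_mul, map_mul, polyToLaurent, Polynomial.aeval_C,
      algebraMap_mul_eq_smul, RingHom.id_apply]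

lemma polyToLaurent_smul (c : ℂ) (f : ℂ[X]) : polyToLaurent (c • f) = c • polyToLaurent f :=
  polyToLaurentₗ.map_smul c f

lemma zcoeff_polyToLaurent (f : ℂ[X]) (n : ℤ) :
    zcoeff (polyToLaurent f) n = if 0 ≤ n then f.coeff n.toNat else 0 := by
  induction f using Polynomial.induction_on' with
  | add f g hf hg =>
    rw [map_add, zcoeff_add, hf, hg, Polynomial.coeff_add]
    split_ifs <;> simp
  | monomial m c =>
    rw [← Polynomial.smul_X_eq_monomial, polyToLaurent_smul, map_pow, polyToLaurent_X, zcoeff_smul,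
      z_pow, zcoeff, HahnSeries.coeff_single, Polynomial.coeff_smul, Polynomial.coeff_X_pow]
    have : -n = -(m : ℤ) ↔ 0 ≤ n ∧ n.toNat = m := by omega
    simp only [this, ite_and]
    split_ifs <;> simp

lemma zcoeff_polyToLaurent_natCast (f : ℂ[X]) (n : ℕ) :
    zcoeff (polyToLaurent f) n = f.coeff n := by
  rw [zcoeff_polyToLaurent, if_pos n.cast_nonneg, Int.toNat_natCast]

lemma zcoeff_polyToLaurent_of_neg (f : ℂ[X]) {n : ℤ} (hn : n < 0) :
    zcoeff (polyToLaurent f) n = 0 := by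
  rw [zcoeff_polyToLaurent, if_neg hn.not_ge]

lemma polyToLaurent_injective : Function.Injective polyToLaurent := fun f g h => by
  ext n
  rw [← zcoeff_polyToLaurent_natCast, h, zcoeff_polyToLaurent_natCast]

/-- The span of the polynomials `basisPoly E` in the Laurent series. -/
def laurentSpan (E : Idx → Fin 3 → ℂ) : Submodule ℂ (LaurentSeries ℂ) :=
  Submodule.span ℂ (Set.range fun j => polyToLaurent (basisPoly E j))

lemma laurentSpan_eq_map (E : Idx → Fin 3 → ℂ) :
    laurentSpan E = (polySpan E).map polyToLaurentₗ := by
  rw [polySpan, Submodule.map_span, ← Set.range_comp]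
  rfl

lemma mulClosed_laurentSpan {E : Idx → Fin 3 → ℂ} (hE : Constraints E) :
    MulClosed (laurentSpan E) := by
  rw [laurentSpan_eq_map]
  rintro _ ⟨f, hf, rfl⟩ _ ⟨g, hg, rfl⟩
  exact ⟨f * g, hE.mul_mem_polySpan hf hg, map_mul polyToLaurent f g⟩

lemma sqInvariant_laurentSpan {E : Idx → Fin 3 → ℂ} (hE : Constraints E) :
    SqInvariant (laurentSpan E) := by
  rw [laurentSpan_eq_map]
  rintro _ ⟨f, hf, rfl⟩
  refine ⟨Polynomial.X ^ 2 * f, hE.sq_mul_mem hf, ?_⟩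
  change polyToLaurent _ = z ^ 2 * polyToLaurent f
  rw [map_mul, map_pow, polyToLaurent_X]

lemma laurentSpan_injective : Function.Injective laurentSpan := fun E E' h => by
  have hspan : polySpan E = polySpan E' := by
    rw [laurentSpan_eq_map, laurentSpan_eq_map] at h
    exact Submodule.map_injective_of_injective (f := polyToLaurentₗ) polyToLaurent_injective h
  funext j
  have hj : genPoly E j = genPoly E' j :=
    eq_of_mem_polySpan (genPoly_mem E j) (by rw [hspan]; exact genPoly_mem E' j) fun l => by
      rw [coeff_genPoly, coeff_genPoly]
  exact evenPoly_injective (add_left_cancel hj)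

/-! ### Closed spans of series -/

section Series

variable (H : Idx → ℤ → ℂ)

lemma zcoeff_ofPowerSeries (f : PowerSeries ℂ) (n : ℤ) :
    zcoeff (HahnSeries.ofPowerSeries ℤ ℂ f) n =
      if n ≤ 0 then PowerSeries.coeff (-n).toNat f else 0 := by
  rw [zcoeff]
  split_ifs with h
  · have := HahnSeries.ofPowerSeries_apply_coeff (Γ := ℤ) f (-n).toNat
    rwa [Int.toNat_of_nonneg (by omega)] at this
  · rw [HahnSeries.ofPowerSeries_apply]
    refine HahnSeries.embDomain_of_notMem_range fun ⟨m, hm⟩ => h ?_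
    have : (m : ℤ) = -n := hm
    omega

/-- The part `∑_{k ≥ 1} H^j_k z^{-k}` of `series H j`. -/
def principalTail (j : Idx) : LaurentSeries ℂ :=
  HahnSeries.ofPowerSeries ℤ ℂ (PowerSeries.mk fun k : ℕ => if k = 0 then 0 else H j k)

lemma zcoeff_principalTail (j : Idx) (n : ℤ) :
    zcoeff (principalTail H j) n = if n < 0 then H j (-n) else 0 := by
  rw [principalTail, zcoeff_ofPowerSeries, PowerSeries.coeff_mk]
  rcases lt_trichotomy n 0 with hn | rfl | hn
  · rw [if_pos hn.le, if_pos hn, if_neg (by omega), Int.toNat_of_nonneg (by omega)]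
  · simp
  · rw [if_neg (by omega), if_neg (by omega)]

lemma series_eq_add (j : Idx) :
    series H j = polyToLaurent (genPoly (evenPart H) j) + principalTail H j := by
  have hC (c : ℂ) : Polynomial.C c = c • (1 : ℂ[X]) := by rw [Polynomial.smul_eq_C_mul, mul_one]
  rw [genPoly, evenPoly_eq]
  simp only [← Polynomial.smul_eq_C_mul, hC (evenPart H j 0), map_add, polyToLaurent_smul, map_pow,
    map_one, polyToLaurent_X, ← add_assoc]
  rfl

lemma zcoeff_series_natCast (j : Idx) (n : ℕ) :
    zcoeff (series H j) n = (genPoly (evenPart H) j).coeff n := by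
  rw [series_eq_add, zcoeff_add, zcoeff_polyToLaurent_natCast, zcoeff_principalTail,
    if_neg (by omega), add_zero]

lemma zcoeff_series_of_neg (j : Idx) {n : ℤ} (hn : n < 0) : zcoeff (series H j) n = H j (-n) := by
  rw [series_eq_add, zcoeff_add, zcoeff_polyToLaurent_of_neg _ hn, zcoeff_principalTail,
    if_pos hn, zero_add]

lemma zcoeff_series_idx (j l : Idx) :
    zcoeff (series H j) (l : ℕ) = if l = j then 1 else 0 := by
  rw [zcoeff_series_natCast, coeff_genPoly]

lemma zcoeff_sum_series (c : Idx →₀ ℂ) (l : Idx) :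
    zcoeff (c.sum fun l c => c • series H l) (l : ℕ) = c l := by
  classical
  simp [Finsupp.sum, zcoeff_sum, zcoeff_smul, zcoeff_series_idx, eq_comm]

variable {H}

lemma series_eq_polyToLaurent {j : Idx} (hj : ∀ k : ℤ, 1 ≤ k → H j k = 0) :
    series H j = polyToLaurent (genPoly (evenPart H) j) := by
  rw [series_eq_add, add_eq_left]
  refine zcoeff_ext fun n => ?_
  rw [zcoeff_principalTail, zcoeff_zero, ite_eq_right_iff]
  exact fun hn => hj _ (by omega)

variable (H) in
/-- The span `⟨p_3, p_5, p_6, …⟩` of the Laurent series `series H`. -/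
def seriesSpan : Submodule ℂ (LaurentSeries ℂ) := Submodule.span ℂ (Set.range (series H))

lemma series_mem (H : Idx → ℤ → ℂ) (j : Idx) : series H j ∈ seriesSpan H :=
  Submodule.subset_span ⟨j, rfl⟩

lemma eq_of_mem_seriesSpan {f g : LaurentSeries ℂ} (hf : f ∈ seriesSpan H) (hg : g ∈ seriesSpan H)
    (h : ∀ l : Idx, zcoeff f (l : ℕ) = zcoeff g (l : ℕ)) : f = g := by
  obtain ⟨c, rfl⟩ := Finsupp.mem_span_range_iff_exists_finsupp.1 hf
  obtain ⟨d, rfl⟩ := Finsupp.mem_span_range_iff_exists_finsupp.1 hg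
  have hcd : c = d := Finsupp.ext fun l => by simpa only [zcoeff_sum_series] using h l
  rw [hcd]

lemma zcoeff_one_eq_zero {f : LaurentSeries ℂ} (hf : f ∈ seriesSpan H) : zcoeff f 1 = 0 := by
  refine (Submodule.span_le (p := (HahnSeries.coeff.linearMap (R := ℂ) (-1)).ker)).2 ?_ hf
  rintro _ ⟨j, rfl⟩
  exact (zcoeff_series_natCast H j 1).trans (coeff_genPoly_one _ j)

lemma zcoeff_eq_zero_of_odd_of_le_one (hsq : SqInvariant (seriesSpan H)) {f : LaurentSeries ℂ}
    (hf : f ∈ seriesSpan H) {n : ℤ} (hn : Odd n) (hn1 : n ≤ 1) : zcoeff f n = 0 := by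
  obtain ⟨k, rfl⟩ : ∃ k : ℕ, n = 1 - 2 * k := by
    obtain ⟨m, rfl⟩ := hn
    exact ⟨(-m).toNat, by omega⟩
  clear hn hn1
  induction k generalizing f with
  | zero => exact zcoeff_one_eq_zero hf
  | succ k ih =>
    have := ih (hsq f hf)
    rw [zcoeff_z_pow_mul] at this
    rw [← this]
    congr 1
    push_cast
    ring

lemma zcoeff_mul_eq_zero_of_odd {f g : LaurentSeries ℂ} (hf : ∀ n, Odd n → zcoeff f n = 0)
    (hg : ∀ n, Odd n → zcoeff g n = 0) {n : ℤ} (hn : Odd n) : zcoeff (f * g) n = 0 :=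
  zcoeff_mul_eq_zero fun i j hij => by
    rcases Int.even_or_odd i with hi | hi
    · exact Or.inr (hg j ((Int.odd_add'.1 (hij ▸ hn)).2 hi))
    · exact Or.inl (hf i hi)

lemma coeff_evenPoly_of_odd {R : Type*} [CommRing R] (v : Fin 3 → R) {n : ℕ} (hn : Odd n) :
    (evenPoly v).coeff n = 0 := by
  have (s : Fin 3) : n ≠ 2 * (s : ℕ) := by rintro rfl; exact absurd hn (by simp)
  simp [evenPoly, Polynomial.coeff_X_pow, this]

lemma zcoeff_series_i3_sub_of_odd (hsq : SqInvariant (seriesSpan H)) {n : ℤ} (hn : Odd n) :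
    zcoeff (series H i3 - z ^ 3) n = 0 := by
  rw [← polyToLaurent_X, ← map_pow]
  rcases lt_or_ge n 0 with hneg | hpos
  · rw [zcoeff_sub, zcoeff_polyToLaurent_of_neg _ hneg, sub_zero]
    exact zcoeff_eq_zero_of_odd_of_le_one hsq (series_mem H i3) hn (by omega)
  · lift n to ℕ using hpos
    have hadd : genPoly (evenPart H) i3 - Polynomial.X ^ 3 = evenPoly (evenPart H i3) :=
      add_sub_cancel_left _ _
    rw [zcoeff_sub, zcoeff_series_natCast, zcoeff_polyToLaurent_natCast, ← Polynomial.coeff_sub,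
      hadd, coeff_evenPoly_of_odd _ (by exact_mod_cast hn)]

/-- With `p_3 = z³ + h`, the odd part of `p_3²` is `2 z³ h`, so `h` has no negative powers. -/
lemma series_i3_tail_eq_zero (hmul : MulClosed (seriesSpan H)) (hsq : SqInvariant (seriesSpan H))
    {k : ℤ} (hk : 1 ≤ k) : H i3 k = 0 := by
  rw [← neg_neg k, ← zcoeff_series_of_neg H i3 (by omega)]
  rcases Int.even_or_odd (-k) with heven | hodd
  · have hodd : Odd (3 - k) := by rw [sub_eq_add_neg]; exact Odd.add_even (by decide) heven
    have hle : 3 - k ≤ 1 := by obtain ⟨m, hm⟩ := heven; omega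
    set h := series H i3 - z ^ 3 with hdef
    have hsquare : series H i3 * series H i3 = z ^ 3 * (series H i3 + h) + h * h := by
      rw [hdef]; ring
    have hcoeff := zcoeff_eq_zero_of_odd_of_le_one hsq
      (hmul _ (series_mem H i3) _ (series_mem H i3)) hodd hle
    have hcube : zcoeff (z ^ 3) (-k) = 0 := by
      rw [← polyToLaurent_X, ← map_pow]
      exact zcoeff_polyToLaurent_of_neg _ (by omega)
    have heven_h (n : ℤ) : Odd n → zcoeff h n = 0 := zcoeff_series_i3_sub_of_odd hsq
    rw [hsquare, zcoeff_add, zcoeff_mul_eq_zero_of_odd heven_h heven_h hodd, add_zero,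
      zcoeff_z_pow_mul, show 3 - k - (3 : ℕ) = -k by push_cast; ring, zcoeff_add, hdef,
      zcoeff_sub, hcube, sub_zero] at hcoeff
    exact add_self_eq_zero.1 hcoeff
  · exact zcoeff_eq_zero_of_odd_of_le_one hsq (series_mem H i3) hodd (by omega)

lemma series_i3_eq (hmul : MulClosed (seriesSpan H)) (hsq : SqInvariant (seriesSpan H))
    (hH : H i3 (-4) = 0) : series H i3 =
      polyToLaurent (.X ^ 3 + (.C (evenPart H i3 1) * .X ^ 2 + .C (evenPart H i3 0))) := by
  rw [series_eq_polyToLaurent fun _ => series_i3_tail_eq_zero hmul hsq,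
    (genPoly_i3_eq_iff (evenPart H)).2 hH]

lemma series_i6_eq (hmul : MulClosed (seriesSpan H)) (hsq : SqInvariant (seriesSpan H))
    (hH : H i3 (-4) = 0) : series H i6 =
      polyToLaurent (.X ^ 6 - (.C (evenPart H i3 1) * .X ^ 2 + .C (evenPart H i3 0)) ^ 2) := by
  have h3 := series_i3_eq hmul hsq hH
  set a := evenPart H i3 1
  set b := evenPart H i3 0
  refine eq_of_mem_seriesSpan (series_mem H i6) ?_ fun l => ?_
  · have hp : polyToLaurent (.X ^ 6 - (.C a * .X ^ 2 + .C b) ^ 2) = series H i3 * series H i3 -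
        (2 * a) • (z ^ 2 * series H i3) - (2 * b) • series H i3 := by
      rw [h3, ← polyToLaurent_X, ← map_pow, ← map_mul, ← map_mul, ← polyToLaurent_smul,
        ← polyToLaurent_smul, ← map_sub, ← map_sub]
      congr 1
      simp only [Polynomial.smul_eq_C_mul, map_mul, map_ofNat]
      ring
    have h3_mem := series_mem H i3
    rw [hp]
    exact sub_mem (sub_mem (hmul _ h3_mem _ h3_mem) (Submodule.smul_mem _ _ (hsq _ h3_mem)))
      (Submodule.smul_mem _ _ h3_mem)
  · rw [zcoeff_series_idx, zcoeff_polyToLaurent_natCast, X_pow_six_sub_sq,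
      coeff_X_pow_add_evenPoly]

lemma sq_mul_series (hsq : SqInvariant (seriesSpan H)) (j : Idx) :
    z ^ 2 * series H j = series H j.addTwo + evenPart H j 2 • series H i6 := by
  refine eq_of_mem_seriesSpan (hsq _ (series_mem H j))
    (add_mem (series_mem H _) (Submodule.smul_mem _ _ (series_mem H _))) fun l => ?_
  have hl := l.2
  have hj : (l : ℕ) - 2 = j ↔ l = j.addTwo := by rw [Subtype.ext_iff, Idx.addTwo_val]; omega
  have h6 : (l : ℕ) - 2 = 4 ↔ l = i6 := by
    rw [Subtype.ext_iff]
    exact ⟨fun h => by simp only [i6]; omega, fun h => by simp [h, i6]⟩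
  have h2 : (l : ℕ) - 2 ≠ 2 := by omega
  have h0 : (l : ℕ) - 2 ≠ 0 := by omega
  rw [zcoeff_z_pow_mul, ← Nat.cast_sub (by omega), zcoeff_series_natCast, zcoeff_add, zcoeff_smul,
    zcoeff_series_idx, zcoeff_series_idx, genPoly, evenPoly_eq]
  simp only [Polynomial.coeff_add, Polynomial.coeff_C_mul, Polynomial.coeff_X_pow,
    Polynomial.coeff_C, hj, h6, if_neg h2, if_neg h0, mul_zero, add_zero]

lemma exists_series_eq_polyToLaurent (hmul : MulClosed (seriesSpan H))
    (hsq : SqInvariant (seriesSpan H)) (hH : H i3 (-4) = 0) (j : Idx) :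
    ∃ f, series H j = polyToLaurent f := by
  induction j using Idx.induction_addTwo with
  | three => exact ⟨_, series_i3_eq hmul hsq hH⟩
  | six => exact ⟨_, series_i6_eq hmul hsq hH⟩
  | addTwo j ih =>
    obtain ⟨f, hf⟩ := ih
    refine ⟨.X ^ 2 * f - evenPart H j 2 •
      (.X ^ 6 - (.C (evenPart H i3 1) * .X ^ 2 + .C (evenPart H i3 0)) ^ 2), ?_⟩
    rw [map_sub, polyToLaurent_smul, ← series_i6_eq hmul hsq hH, map_mul, map_pow,
      polyToLaurent_X, ← hf, sq_mul_series hsq, add_sub_cancel_right]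

theorem series_tail_eq_zero (hmul : MulClosed (seriesSpan H)) (hsq : SqInvariant (seriesSpan H))
    (hH : H i3 (-4) = 0) (j : Idx) {k : ℤ} (hk : 1 ≤ k) : H j k = 0 := by
  obtain ⟨f, hf⟩ := exists_series_eq_polyToLaurent hmul hsq hH j
  rw [← neg_neg k, ← zcoeff_series_of_neg H j (by omega), hf,
    zcoeff_polyToLaurent_of_neg f (by omega)]

theorem constraints_evenPart (hmul : MulClosed (seriesSpan H)) (hsq : SqInvariant (seriesSpan H))
    (hH : H i3 (-4) = 0) : Constraints (evenPart H) := by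
  have hpoly (j : Idx) : series H j = polyToLaurent (genPoly (evenPart H) j) :=
    series_eq_polyToLaurent fun _ => series_tail_eq_zero hmul hsq hH j
  refine (constraints_iff_genPoly _).2 ⟨(genPoly_i3_eq_iff _).2 hH, ?_, fun j => ?_⟩
  · exact polyToLaurent_injective ((hpoly i6).symm.trans (series_i6_eq hmul hsq hH))
  · apply polyToLaurent_injective
    rw [map_sub, map_mul, map_pow, polyToLaurent_X, Polynomial.C_mul', polyToLaurent_smul, ← hpoly,
      ← hpoly, ← hpoly, sq_mul_series hsq, add_sub_cancel_right]

lemma mulClosed_seriesSpan_iff (H : Idx → ℤ → ℂ) : MulClosed (seriesSpan H) ↔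
    ∃ C : Idx → Idx → (Idx →₀ ℂ), ∀ j k,
      series H j * series H k = (C j k).sum fun l c => c • series H l := by
  have hmul : MulClosed (seriesSpan H) ↔ ∀ j k, series H j * series H k ∈ seriesSpan H := by
    refine ⟨fun h j k => h _ (series_mem H j) _ (series_mem H k), fun h f hf g hg => ?_⟩
    refine LinearMap.BilinMap.apply_apply_mem_of_mem_span (seriesSpan H) _ _
      (LinearMap.mul ℂ (LaurentSeries ℂ)) ?_ f g hf hg
    rintro _ ⟨j, rfl⟩ _ ⟨k, rfl⟩
    exact h j k
  rw [hmul]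
  simp only [seriesSpan, Finsupp.mem_span_range_iff_exists_finsupp, Classical.skolem, eq_comm]

theorem closed_series_iff (hH : H i3 (-4) = 0) :
    ((∃ C : Idx → Idx → (Idx →₀ ℂ), ∀ j k,
        series H j * series H k = (C j k).sum fun l c => c • series H l) ∧
      SqInvariant (seriesSpan H)) ↔
    ((∀ j, ∀ k : ℤ, 1 ≤ k → H j k = 0) ∧ Constraints (evenPart H)) := by
  rw [← mulClosed_seriesSpan_iff]
  refine ⟨fun ⟨hmul, hsq⟩ => ⟨fun j _ => series_tail_eq_zero hmul hsq hH j,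
    constraints_evenPart hmul hsq hH⟩, fun ⟨htail, hE⟩ => ?_⟩
  have hspan : seriesSpan H = laurentSpan (evenPart H) :=
    congrArg (fun p => Submodule.span ℂ (Set.range p))
      (funext fun j => series_eq_polyToLaurent (htail j))
  rw [hspan]
  exact ⟨mulClosed_laurentSpan hE, sqInvariant_laurentSpan hE⟩

theorem structConst_of_series (hsq : SqInvariant (seriesSpan H)) (hH : H i3 (-4) = 0)
    {C : Idx → Idx → (Idx →₀ ℂ)}
    (hC : ∀ j k, series H j * series H k = (C j k).sum fun l c => c • series H l) (j k l : Idx) :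
    C j k l = structConst (evenPart H) j k l := by
  have hmul := (mulClosed_seriesSpan_iff H).2 ⟨C, hC⟩
  have hpoly (j : Idx) : series H j = polyToLaurent (genPoly (evenPart H) j) :=
    series_eq_polyToLaurent fun _ => series_tail_eq_zero hmul hsq hH j
  rw [← zcoeff_sum_series H, ← hC, hpoly, hpoly, ← map_mul, zcoeff_polyToLaurent_natCast,
    coeff_genPoly_mul]

end Series

end Laurent

/-! ### Orders -/

section Orders

lemma hasOrder_iff {f : LaurentSeries ℂ} {n : ℤ} : HasOrder f n ↔ f ≠ 0 ∧ n = -f.order := by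
  constructor
  · rintro ⟨hn, hgt⟩
    have hf : f ≠ 0 := by rintro rfl; exact hn rfl
    refine ⟨hf, le_antisymm ?_ (not_lt.1 fun h => ?_)⟩
    · exact le_neg_of_le_neg (HahnSeries.order_le_of_coeff_ne_zero hn)
    · refine hf (HahnSeries.coeff_order_eq_zero.1 ?_)
      simpa only [zcoeff, neg_neg] using hgt _ h
  · rintro ⟨hf, rfl⟩
    refine ⟨?_, fun m hm => HahnSeries.coeff_eq_zero_of_lt_order (by omega)⟩
    rw [zcoeff, neg_neg]
    exact mt HahnSeries.coeff_order_eq_zero.1 hf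

lemma HasOrder.unique {f : LaurentSeries ℂ} {m n : ℤ} (hm : HasOrder f m) (hn : HasOrder f n) :
    m = n :=
  (hasOrder_iff.1 hm).2.trans (hasOrder_iff.1 hn).2.symm

lemma HasOrder.mul {f g : LaurentSeries ℂ} {m n : ℤ} (hf : HasOrder f m) (hg : HasOrder g n) :
    HasOrder (f * g) (m + n) := by
  rw [hasOrder_iff] at *
  refine ⟨mul_ne_zero hf.1 hg.1, ?_⟩
  rw [HahnSeries.order_mul hf.1 hg.1, hf.2, hg.2, neg_add]

/-- The set of orders of the nonzero elements of a space of Laurent series. -/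
def orders (V : Submodule ℂ (LaurentSeries ℂ)) : Set ℤ := {n | ∃ f ∈ V, HasOrder f n}

/-- Subtracting from `f` a multiple of an element of `U` with the same order lowers the order, so
an element of `V \ U` of minimal order cannot exist. -/
lemma le_of_orders_subset {U V : Submodule ℂ (LaurentSeries ℂ)} (hUV : U ≤ V)
    (hV : BddBelow (orders V)) (h : orders V ⊆ orders U) : V ≤ U := by
  by_contra hle
  obtain ⟨f₀, hf₀V, hf₀U⟩ := SetLike.not_le_iff_exists.1 hle
  have hf₀ : f₀ ≠ 0 := fun h => hf₀U (h ▸ zero_mem U)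
  obtain ⟨N, hN⟩ := hV
  obtain ⟨n, ⟨f, hfV, hfU, hfn⟩, hmin⟩ :=
    Int.exists_least_of_bdd (P := fun n => ∃ f ∈ V, f ∉ U ∧ HasOrder f n)
      ⟨N, fun _ ⟨f, hf, _, hfn⟩ => hN ⟨f, hf, hfn⟩⟩
      ⟨_, f₀, hf₀V, hf₀U, hasOrder_iff.2 ⟨hf₀, rfl⟩⟩
  obtain ⟨g, hgU, hgn⟩ := h ⟨f, hfV, hfn⟩
  set f' := f - (zcoeff f n / zcoeff g n) • g
  have hf'U : f' ∉ U := mt (U.sub_mem_iff_left (U.smul_mem _ hgU)).1 hfU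
  have hf' : f' ≠ 0 := fun h => hf'U (h ▸ zero_mem U)
  have hord := hasOrder_iff.2 ⟨hf', rfl⟩
  have hlt : -f'.order < n := by
    refine not_le.1 fun hle => hord.1 ?_
    rw [zcoeff_sub, zcoeff_smul]
    rcases hle.eq_or_lt with heq | hgt
    · rw [← heq, div_mul_cancel₀ _ hgn.1, sub_self]
    · rw [hfn.2 _ hgt, hgn.2 _ hgt, mul_zero, sub_zero]
  exact hlt.not_ge (hmin _ ⟨f', sub_mem hfV (V.smul_mem _ (hUV hgU)), hf'U, hord⟩)

/-- `f` is `z ^ n` plus lower powers. -/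
def IsMonicOfOrder (f : LaurentSeries ℂ) (n : ℤ) : Prop :=
  zcoeff f n = 1 ∧ ∀ m : ℤ, n < m → zcoeff f m = 0

lemma IsMonicOfOrder.hasOrder {f : LaurentSeries ℂ} {n : ℤ} (h : IsMonicOfOrder f n) :
    HasOrder f n :=
  ⟨by rw [h.1]; exact one_ne_zero, h.2⟩

lemma subset_orders_span {S : Set ℤ} {p : ℤ → LaurentSeries ℂ}
    (hp : ∀ s ∈ S, IsMonicOfOrder (p s) s) : S ⊆ orders (Submodule.span ℂ (p '' S)) :=
  fun s hs => ⟨p s, Submodule.subset_span ⟨s, hs, rfl⟩, (hp s hs).hasOrder⟩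

lemma hasOrder_sum_smul {t : Finset ℤ} (ht : t.Nonempty) {p : ℤ → LaurentSeries ℂ} {c : ℤ → ℂ}
    (hp : ∀ s ∈ t, IsMonicOfOrder (p s) s) (hc : ∀ s ∈ t, c s ≠ 0) :
    HasOrder (∑ s ∈ t, c s • p s) (t.max' ht) := by
  have hmax := t.max'_mem ht
  constructor
  · rw [zcoeff_sum, Finset.sum_eq_single_of_mem _ hmax, zcoeff_smul, (hp _ hmax).1, mul_one]
    · exact hc _ hmax
    · intro s hs hne
      rw [zcoeff_smul, (hp s hs).2 _ (lt_of_le_of_ne (t.le_max' s hs) hne), mul_zero]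
  · intro m hm
    rw [zcoeff_sum]
    refine Finset.sum_eq_zero fun s hs => ?_
    rw [zcoeff_smul, (hp s hs).2 m ((t.le_max' s hs).trans_lt hm), mul_zero]

theorem orders_span {S : Set ℤ} {p : ℤ → LaurentSeries ℂ}
    (hp : ∀ s ∈ S, IsMonicOfOrder (p s) s) : orders (Submodule.span ℂ (p '' S)) = S := by
  refine subset_antisymm ?_ (subset_orders_span hp)
  rintro n ⟨f, hf, hn⟩
  obtain ⟨c, hc, rfl⟩ := (Finsupp.mem_span_image_iff_linearCombination ℂ).1 hf
  have hne : c.support.Nonempty := by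
    rw [Finsupp.support_nonempty_iff]
    rintro rfl
    exact (hasOrder_iff.1 hn).1 (map_zero _)
  have hmax : HasOrder (Finsupp.linearCombination ℂ p c) (c.support.max' hne) :=
    hasOrder_sum_smul hne (fun s hs => hp s (hc hs)) fun s => Finsupp.mem_support_iff.1
  rw [hn.unique hmax]
  exact hc (c.support.max'_mem hne)

end Orders

/-! ### Closed subspaces of the points of `Σ_5` -/

lemma mem_closedOrders {s : ℤ} : s ∈ closedOrders ↔ s = 3 ∨ 5 ≤ s := Iff.rfl

lemma mem_stratumIndex_five {s : ℤ} :
    s ∈ stratumIndex 5 ↔ s = -5 ∨ s = -3 ∨ s = -1 ∨ s = 1 ∨ s ∈ closedOrders := by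
  simp only [stratumIndex, closedOrders, Set.mem_ofPred_eq, Int.even_iff]
  push_cast
  omega

lemma closedOrders_subset : closedOrders ⊆ stratumIndex 5 := fun _ hs =>
  mem_stratumIndex_five.2 (Or.inr (Or.inr (Or.inr (Or.inr hs))))

/-- Twice an order of a closed subspace is again an order, while `S_5` does not contain the
doubles of `-5`, `-3`, `-1` and `1`. -/
theorem orders_subset_closedOrders {W V : Submodule ℂ (LaurentSeries ℂ)} (hW : W ∈ stratum 5)
    (hVW : V ≤ W) (hV : MulClosed V) : orders V ⊆ closedOrders := by
  rintro n ⟨f, hf, hn⟩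
  have hmem : n ∈ stratumIndex 5 := hW.2 ▸ ⟨f, hVW hf, hn⟩
  have hdouble : n + n ∈ stratumIndex 5 := hW.2 ▸ ⟨f * f, hVW (hV f hf f hf), hn.mul hn⟩
  rw [mem_stratumIndex_five] at hmem hdouble
  rw [mem_closedOrders] at *
  omega

section CanonicalBasis

variable {m : ℕ} {W : Submodule ℂ (LaurentSeries ℂ)} {p : ℤ → LaurentSeries ℂ}

lemma IsCanonicalBasis.isMonicOfOrder (hp : IsCanonicalBasis m W p) {s : ℤ}
    (hs : s ∈ stratumIndex m) : IsMonicOfOrder (p s) s :=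
  ⟨(hp s hs).2.1, (hp s hs).2.2.1⟩

lemma IsCanonicalBasis.span_le (hp : IsCanonicalBasis m W p) {T : Set ℤ}
    (hT : T ⊆ stratumIndex m) : Submodule.span ℂ (p '' T) ≤ W := by
  rw [Submodule.span_le]
  rintro _ ⟨s, hs, rfl⟩
  exact (hp s (hT hs)).1

theorem subset_closedOrders_of_mulClosed (hW : W ∈ stratum 5) (hp : IsCanonicalBasis 5 W p)
    {T : Set ℤ} (hT : T ⊆ stratumIndex 5) (hmul : MulClosed (Submodule.span ℂ (p '' T))) :
    T ⊆ closedOrders :=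
  (subset_orders_span fun _ hs => hp.isMonicOfOrder (hT hs)).trans
    (orders_subset_closedOrders hW (hp.span_le hT) hmul)

theorem eq_span_closedOrders_of_le (hW : W ∈ stratum 5) (hp : IsCanonicalBasis 5 W p)
    {V : Submodule ℂ (LaurentSeries ℂ)} (hVW : V ≤ W) (hV : MulClosed V)
    (hle : Submodule.span ℂ (p '' closedOrders) ≤ V) :
    V = Submodule.span ℂ (p '' closedOrders) := by
  have hsub := orders_subset_closedOrders hW hVW hV
  have hbdd : BddBelow closedOrders := ⟨3, fun s hs => by rw [mem_closedOrders] at hs; omega⟩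
  exact le_antisymm (le_of_orders_subset hle (hbdd.mono hsub) (hsub.trans
    (subset_orders_span fun _ hs => hp.isMonicOfOrder (closedOrders_subset hs)))) hle

/-! ### The family `W_5` -/

lemma mem_closedOrders_iff_exists_idx {s : ℤ} : s ∈ closedOrders ↔ ∃ j : Idx, (j : ℕ) = s := by
  rw [mem_closedOrders]
  constructor
  · exact fun hs => ⟨⟨s.toNat, by omega⟩, by simp only; omega⟩
  · rintro ⟨j, rfl⟩
    have := j.2
    omega

lemma image_closedOrders (p : ℤ → LaurentSeries ℂ) :
    p '' closedOrders = Set.range fun j : Idx => p (j : ℕ) := by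
  ext f
  simp only [Set.mem_image, mem_closedOrders_iff_exists_idx, Set.mem_range,
    exists_exists_eq_and]

lemma eq_one_or_two_mul_or_idx (n : ℕ) :
    n = 1 ∨ (∃ s : Fin 3, n = 2 * s) ∨ ∃ l : Idx, n = l := by
  by_cases hodd : n = 3 ∨ 5 ≤ n
  · exact Or.inr (Or.inr ⟨⟨n, hodd⟩, rfl⟩)
  · obtain rfl | rfl | rfl | rfl : n = 0 ∨ n = 1 ∨ n = 2 ∨ n = 4 := by omega
    exacts [Or.inr (Or.inl ⟨0, rfl⟩), Or.inl rfl, Or.inr (Or.inl ⟨1, rfl⟩),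
      Or.inr (Or.inl ⟨2, rfl⟩)]

lemma IsCanonicalBasis.eq_series (hp : IsCanonicalBasis 5 W p) (j : Idx) :
    p (j : ℕ) = series (fun i k => zcoeff (p (i : ℕ)) (-k)) j := by
  have hj := mem_closedOrders_iff_exists_idx.2 ⟨j, rfl⟩
  have hcoeff (i : ℕ) (hi : (i : ℤ) ∈ stratumIndex 5) :
      zcoeff (p (j : ℕ)) i = if i = j then 1 else 0 := by
    obtain ⟨-, hone, hgt, hlt⟩ := hp _ (closedOrders_subset hj)
    rcases lt_trichotomy i j with h | rfl | h
    · rw [if_neg h.ne, hlt i hi (by omega) (by omega)]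
    · rw [if_pos rfl, hone]
    · rw [if_neg h.ne', hgt i (by omega)]
  refine zcoeff_ext fun n => ?_
  rcases lt_or_ge n 0 with hneg | hpos
  · rw [zcoeff_series_of_neg _ _ hneg, neg_neg]
  lift n to ℕ using hpos
  rw [zcoeff_series_natCast]
  obtain rfl | ⟨s, rfl⟩ | ⟨l, rfl⟩ := eq_one_or_two_mul_or_idx n
  · have hne : 1 ≠ (j : ℕ) := by have := j.2; omega
    rw [coeff_genPoly_one, hcoeff 1 (mem_stratumIndex_five.2 (by simp)), if_neg hne]
  · rw [coeff_genPoly_two_mul, evenPart]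
    congr 1
    push_cast
    ring
  · rw [coeff_genPoly,
      hcoeff l (closedOrders_subset (mem_closedOrders_iff_exists_idx.2 ⟨l, rfl⟩))]
    simp only [Subtype.ext_iff]

end CanonicalBasis

lemma exists_constraints_of_mem_W5 {U : Submodule ℂ (LaurentSeries ℂ)} (hU : U ∈ W5) :
    ∃ E : Idx → Fin 3 → ℂ, Constraints E ∧ U = laurentSpan E := by
  obtain ⟨hmul, hsq, W, -, p, hp, rfl⟩ := hU
  set H : Idx → ℤ → ℂ := fun i k => zcoeff (p (i : ℕ)) (-k)
  have hspan : Submodule.span ℂ (p '' closedOrders) = seriesSpan H := by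
    rw [image_closedOrders, funext hp.eq_series, seriesSpan]
  have hH : H i3 (-4) = 0 := (hp 3 (closedOrders_subset (Or.inl rfl))).2.2.1 4 (by norm_num)
  rw [hspan] at hmul hsq ⊢
  refine ⟨evenPart H, constraints_evenPart hmul hsq hH, ?_⟩
  exact congrArg (fun q => Submodule.span ℂ (Set.range q)) (funext fun j =>
    series_eq_polyToLaurent fun _ => series_tail_eq_zero hmul hsq hH j)

lemma z_zpow (k : ℤ) : z ^ k = HahnSeries.single (-k) 1 := by
  rw [RatFunc.single_zpow, zpow_neg, ← inv_zpow, HahnSeries.inv_single, inv_one, z]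

lemma z_ne_zero : z ≠ 0 := by simp [z]

lemma zcoeff_z_zpow_mul (k : ℤ) (f : LaurentSeries ℂ) (n : ℤ) :
    zcoeff (z ^ k * f) n = zcoeff f (n - k) := by
  rw [z_zpow, zcoeff, HahnSeries.coeff_single_mul, one_mul, zcoeff]
  congr 1
  ring

/-- A canonical basis of a point of `Σ_5` that contains `p_3, p_5, p_6, …`: it is completed by
`z⁻⁸ p_3, z⁻⁶ p_3, z⁻⁴ p_3, z⁻² p_3`. -/
def stratumBasis (E : Idx → Fin 3 → ℂ) (s : ℤ) : LaurentSeries ℂ :=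
  if h : s.toNat = 3 ∨ 5 ≤ s.toNat then polyToLaurent (genPoly E ⟨s.toNat, h⟩)
  else z ^ (s - 3) * polyToLaurent (genPoly E i3)

section StratumBasis

variable {E : Idx → Fin 3 → ℂ}

lemma stratumBasis_idx (j : Idx) :
    stratumBasis E (j : ℕ) = polyToLaurent (genPoly E j) :=
  dif_pos j.2

lemma stratumBasis_of_le_three {s : ℤ} (hs : s ≤ 3) :
    stratumBasis E s = z ^ (s - 3) * polyToLaurent (genPoly E i3) := by
  rcases hs.eq_or_lt with rfl | hlt
  · rw [sub_self, zpow_zero, one_mul]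
    exact stratumBasis_idx i3
  · exact dif_neg (by omega)

lemma span_stratumBasis_closedOrders :
    Submodule.span ℂ (stratumBasis E '' closedOrders) = laurentSpan E := by
  rw [image_closedOrders]
  simp only [stratumBasis_idx]
  rfl

lemma isMonicOfOrder_polyToLaurent_genPoly (h3 : E i3 2 = 0) (j : Idx) :
    IsMonicOfOrder (polyToLaurent (genPoly E j)) (j : ℕ) := by
  constructor
  · rw [zcoeff_polyToLaurent_natCast, coeff_genPoly, if_pos rfl]
  · intro m hm
    lift m to ℕ using (Int.natCast_nonneg _).trans hm.le
    rw [zcoeff_polyToLaurent_natCast]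
    refine Polynomial.coeff_eq_zero_of_natDegree_lt ?_
    rw [natDegree_genPoly h3]
    exact_mod_cast hm

lemma isMonicOfOrder_stratumBasis (h3 : E i3 2 = 0) {s : ℤ} (hs : s ∈ stratumIndex 5) :
    IsMonicOfOrder (stratumBasis E s) s := by
  by_cases hc : s ∈ closedOrders
  · obtain ⟨j, rfl⟩ := mem_closedOrders_iff_exists_idx.1 hc
    rw [stratumBasis_idx]
    exact isMonicOfOrder_polyToLaurent_genPoly h3 j
  · have hle : s ≤ 3 := by
      rw [mem_stratumIndex_five] at hs
      rw [mem_closedOrders] at hs hc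
      omega
    obtain ⟨hone, hgt⟩ := isMonicOfOrder_polyToLaurent_genPoly h3 i3
    simp only [IsMonicOfOrder, stratumBasis_of_le_three hle, zcoeff_z_zpow_mul, sub_sub_cancel]
    exact ⟨hone, fun m hm => hgt _ (by simp only [i3, Nat.cast_ofNat]; omega)⟩

lemma sqInvariant_span_stratumBasis (hE : Constraints E) :
    SqInvariant (Submodule.span ℂ (stratumBasis E '' stratumIndex 5)) := by
  set W := Submodule.span ℂ (stratumBasis E '' stratumIndex 5)
  suffices h : stratumBasis E '' stratumIndex 5 ⊆ W.comap (LinearMap.mulLeft ℂ (z ^ 2)) from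
    fun _ hf => Submodule.span_le.2 h hf
  rintro _ ⟨s, hs, rfl⟩
  change z ^ 2 * stratumBasis E s ∈ W
  by_cases hc : s ∈ closedOrders
  · have hmem : stratumBasis E s ∈ laurentSpan E := by
      rw [← span_stratumBasis_closedOrders]
      exact Submodule.subset_span ⟨s, hc, rfl⟩
    have hsq := sqInvariant_laurentSpan hE _ hmem
    rw [← span_stratumBasis_closedOrders] at hsq
    exact Submodule.span_mono (Set.image_mono closedOrders_subset) hsq
  · rw [mem_stratumIndex_five, mem_closedOrders] at hs
    rw [mem_closedOrders] at hc
    refine Submodule.subset_span ⟨s + 2, ?_, ?_⟩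
    · rw [mem_stratumIndex_five, mem_closedOrders]
      omega
    · rw [stratumBasis_of_le_three (by omega), stratumBasis_of_le_three (by omega), ← mul_assoc,
        ← zpow_natCast, ← zpow_add₀ z_ne_zero, Nat.cast_ofNat, add_sub_right_comm, add_comm]

lemma isCanonicalBasis_stratumBasis (h3 : E i3 2 = 0) :
    IsCanonicalBasis 5 (Submodule.span ℂ (stratumBasis E '' stratumIndex 5)) (stratumBasis E) := by
  intro s hs
  refine ⟨Submodule.subset_span ⟨s, hs, rfl⟩, (isMonicOfOrder_stratumBasis h3 hs).1,
    (isMonicOfOrder_stratumBasis h3 hs).2, fun i hi hi0 his => ?_⟩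
  rw [mem_stratumIndex_five] at hs hi
  have hc : s ∈ closedOrders := by
    rw [mem_closedOrders] at *; omega
  obtain ⟨j, rfl⟩ := mem_closedOrders_iff_exists_idx.1 hc
  lift i to ℕ using hi0
  rw [stratumBasis_idx, zcoeff_polyToLaurent_natCast]
  obtain rfl | ⟨r, rfl⟩ | ⟨l, rfl⟩ := eq_one_or_two_mul_or_idx i
  · exact coeff_genPoly_one E j
  · rw [mem_closedOrders] at hi
    omega
  · exact (coeff_genPoly E j l).trans (if_neg fun h => by simp [h] at his)

lemma laurentSpan_mem_W5 (hE : Constraints E) : laurentSpan E ∈ W5 :=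
  have h3 : E i3 2 = 0 := ((constraints_iff E).1 hE).1
  ⟨mulClosed_laurentSpan hE, sqInvariant_laurentSpan hE, _,
    ⟨sqInvariant_span_stratumBasis hE, orders_span fun _ => isMonicOfOrder_stratumBasis h3⟩,
    stratumBasis E, isCanonicalBasis_stratumBasis h3, span_stratumBasis_closedOrders.symm⟩

end StratumBasis

theorem mem_W5_iff (U : Submodule ℂ (LaurentSeries ℂ)) :
    U ∈ W5 ↔ ∃! E : Idx → Fin 3 → ℂ, Constraints E ∧ U = laurentSpan E := by
  constructor
  · intro hU
    obtain ⟨E, hE, rfl⟩ := exists_constraints_of_mem_W5 hU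
    exact ⟨E, ⟨hE, rfl⟩, fun E' h => (laurentSpan_injective h.2).symm⟩
  · rintro ⟨E, ⟨hE, rfl⟩, -⟩
    exact laurentSpan_mem_W5 hE

/-! ### Regular differentials of a rational function field -/

section Differentials

open IsDedekindDomain KaehlerDifferential Polynomial

open scoped IntermediateField

variable {k F : Type*} [Field k] [Field F] [Algebra k F]

lemma derivation_div_eq_smul {M : Type*} [AddCommGroup M] [Module k M] [Module F M]
    (D : Derivation k F M) {u : M} {x y g h : F} (hx : D x = g • u) (hy : D y = h • u) :
    D (x / y) = (y⁻¹ ^ 2 * (y * g - x * h)) • u := by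
  rw [D.leibniz_div, hx, hy, smul_smul, smul_smul, ← sub_smul, smul_smul]

lemma exists_mem_eq_smul_of_mem_span (A : ValuationSubring F) {u ω : Ω[F⁄k]}
    (hu : ∀ x ∈ A, ∃ g ∈ A, D k F x = g • u)
    (hω : ω ∈ Submodule.span A.toSubring (Set.range fun x : A => D k F (x : F))) :
    ∃ g ∈ A, ω = g • u := by
  suffices hle : Submodule.span A.toSubring (Set.range fun x : A => D k F (x : F)) ≤
      A.toSubring ∙ u by
    obtain ⟨g, rfl⟩ := Submodule.mem_span_singleton.1 (hle hω)
    exact ⟨g, g.2, rfl⟩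
  refine Submodule.span_le.2 ?_
  rintro _ ⟨x, rfl⟩
  obtain ⟨g, hg, hgu⟩ := hu x x.2
  exact Submodule.mem_span_singleton.2 ⟨⟨g, hg⟩, hgu.symm⟩

section Dedekind

variable {R : Type*} [CommRing R] [Algebra R F] [IsFractionRing R F] {u : Ω[F⁄k]}

lemma span_singleton_eq_top_of_D_algebraMap
    (hu : ∀ r : R, ∃ g : R, D k F (algebraMap R F r) = algebraMap R F g • u) : F ∙ u = ⊤ := by
  rw [eq_top_iff, ← span_range_derivation, Submodule.span_le]
  rintro _ ⟨x, rfl⟩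
  obtain ⟨r, s, -, rfl⟩ := IsFractionRing.div_surjective (A := R) x
  obtain ⟨g, hg⟩ := hu r
  obtain ⟨h, hh⟩ := hu s
  rw [derivation_div_eq_smul _ hg hh]
  exact Submodule.smul_mem _ _ (Submodule.mem_span_singleton_self u)

variable [IsDedekindDomain R]

lemma exists_mem_valuationSubring_D_eq_smul
    (hu : ∀ r : R, ∃ g : R, D k F (algebraMap R F r) = algebraMap R F g • u)
    (v : HeightOneSpectrum R) {x : F} (hx : x ∈ (v.valuation F).valuationSubring) :
    ∃ g ∈ (v.valuation F).valuationSubring, D k F x = g • u := by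
  obtain ⟨r, s, hrs⟩ := v.exists_primeCompl_mul_eq_of_integer x hx
  have hs : algebraMap R F s ≠ 0 := by
    rw [Ne, FaithfulSMul.algebraMap_eq_zero_iff]
    exact fun h => s.2 (h ▸ v.asIdeal.zero_mem)
  have hmem (y : R) : algebraMap R F y ∈ (v.valuation F).valuationSubring := v.valuation_le_one y
  have hinv : (algebraMap R F s)⁻¹ ∈ (v.valuation F).valuationSubring := by
    rw [Valuation.mem_valuationSubring_iff, map_inv₀, v.valuation_of_algebraMap,
      (v.intValuation_eq_one_iff_mem_primeCompl s).2 s.2, inv_one]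
  obtain ⟨g, hg⟩ := hu r
  obtain ⟨h, hh⟩ := hu s
  rw [eq_div_of_mul_eq hs hrs]
  exact ⟨_, mul_mem (pow_mem hinv 2)
    (sub_mem (mul_mem (hmem _) (hmem _)) (mul_mem (hmem _) (hmem _))),
    derivation_div_eq_smul _ hg hh⟩

lemma exists_eq_algebraMap_smul_of_mem_regularDifferentials [Algebra k R] [IsScalarTower k R F]
    (hu : ∀ r : R, ∃ g : R, D k F (algebraMap R F r) = algebraMap R F g • u) {ω : Ω[F⁄k]}
    (hω : ω ∈ regularDifferentials k F) : ∃ g : R, ω = algebraMap R F g • u := by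
  obtain ⟨f, rfl⟩ : ∃ f : F, f • u = ω := Submodule.mem_span_singleton.1 <| by
    rw [span_singleton_eq_top_of_D_algebraMap hu]
    exact Submodule.mem_top
  obtain rfl | hu0 := eq_or_ne u 0
  · exact ⟨0, by simp only [smul_zero]⟩
  have hf (v : HeightOneSpectrum R) : v.valuation F f ≤ 1 := by
    have hk (c : k) : algebraMap k F c ∈ (v.valuation F).valuationSubring := by
      rw [IsScalarTower.algebraMap_apply k R F]
      exact v.valuation_le_one _
    obtain ⟨g, hg, hfg⟩ := exists_mem_eq_smul_of_mem_span _
      (fun _ hx => exists_mem_valuationSubring_D_eq_smul hu v hx) (hω _ hk)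
    rwa [smul_left_injective F hu0 hfg]
  obtain ⟨r, rfl⟩ := HeightOneSpectrum.mem_integers_of_valuation_le_one F f hf
  exact ⟨r, rfl⟩

end Dedekind

variable {t : F}

lemma exists_eq_aeval_smul_D_of_mem_regularDifferentials (ht : Transcendental k t)
    (htop : k⟮t⟯ = ⊤) {ω : Ω[F⁄k]} (hω : ω ∈ regularDifferentials k F) :
    ∃ p : k[X], ω = aeval t p • D k F t := by
  let := (aeval t : k[X] →ₐ[k] F).toAlgebra
  have : IsScalarTower k k[X] F := .of_algebraMap_eq fun c => (aeval_C t c).symm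
  have : FaithfulSMul k[X] F :=
    (faithfulSMul_iff_algebraMap_injective _ _).2 (transcendental_iff_injective.1 ht)
  have : IsFractionRing k[X] F := IsFractionRing.of_field _ _ fun z =>
    (IntermediateField.mem_adjoin_simple_iff k z).1 (htop ▸ IntermediateField.mem_top)
  exact exists_eq_algebraMap_smul_of_mem_regularDifferentials
    (fun p => ⟨derivative p, (D k F).map_aeval p t⟩) hω

lemma adjoin_inv_eq_top (htop : k⟮t⟯ = ⊤) : k⟮t⁻¹⟯ = ⊤ := by
  rw [eq_top_iff, ← htop, IntermediateField.adjoin_simple_le_iff]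
  simpa using inv_mem (IntermediateField.mem_adjoin_simple_self k t⁻¹)

lemma eq_zero_of_aeval_mul_sq_eq_aeval_inv (ht : Transcendental k t) {p q : k[X]}
    (h : aeval t p * t ^ 2 = aeval t⁻¹ q) : p = 0 := by
  have ht0 : t ≠ 0 := fun h0 => ht (h0 ▸ isAlgebraic_zero)
  have hrev : aeval t q.reverse = aeval t⁻¹ q * t ^ q.natDegree := by
    let := invertibleOfNonzero (inv_ne_zero ht0)
    have := eval₂_reverse_mul_pow (algebraMap k F) t⁻¹ q
    rw [invOf_eq_inv, inv_inv, inv_pow] at this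
    exact (mul_inv_eq_iff_eq_mul₀ (pow_ne_zero _ ht0)).1 this
  have hpq : p * X ^ (2 + q.natDegree) = q.reverse := by
    refine transcendental_iff_injective.1 ht ?_
    rw [map_mul, map_pow, aeval_X, hrev, ← h, pow_add, mul_assoc]
  by_contra hp
  have hdeg := hpq ▸ q.reverse_natDegree_le
  rw [natDegree_mul_X_pow _ hp] at hdeg
  omega

lemma regularDifferentials_eq_bot_of_adjoin_eq_top (ht : Transcendental k t) (htop : k⟮t⟯ = ⊤) :
    regularDifferentials k F = ⊥ := by
  refine (Submodule.eq_bot_iff _).2 fun ω hω => ?_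
  obtain ⟨p, rfl⟩ := exists_eq_aeval_smul_D_of_mem_regularDifferentials ht htop hω
  obtain ⟨q, hq⟩ := exists_eq_aeval_smul_D_of_mem_regularDifferentials
    (fun h => ht (IsAlgebraic.inv_iff.1 h)) (adjoin_inv_eq_top htop) hω
  obtain h0 | h0 := eq_or_ne (D k F t) 0
  · rw [h0, smul_zero]
  have ht0 : t ≠ 0 := fun h => ht (h ▸ isAlgebraic_zero)
  rw [Derivation.leibniz_inv, smul_smul] at hq
  have hpq : aeval t p * t ^ 2 = aeval t⁻¹ (-q) := by
    rw [smul_left_injective F h0 hq, map_neg]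
    field_simp
  rw [eq_zero_of_aeval_mul_sq_eq_aeval_inv ht hpq, map_zero, zero_smul]

theorem regularDifferentials_eq_bot (e : F ≃ₐ[k] RatFunc k) : regularDifferentials k F = ⊥ := by
  let φ : RatFunc k →ₐ[k] F := e.symm
  refine regularDifferentials_eq_bot_of_adjoin_eq_top (t := φ RatFunc.X)
    (fun h => RatFunc.transcendental_X ((isAlgebraic_algHom_iff φ φ.injective).1 h)) ?_
  rw [← Set.image_singleton, ← IntermediateField.adjoin_map, RatFunc.adjoin_X,
    ← AlgHom.fieldRange_eq_map, AlgEquiv.fieldRange_eq_top]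

end Differentials

/-! ### Plane curves with a polynomial parametrization -/

section Parametrization

open Polynomial Polynomial.Bivariate

open scoped IntermediateField

variable {k : Type*} [Field k] {P Q : k[X]}

lemma finrank_adjoin_algebraMap (P : k[X]) :
    Module.finrank k⟮algebraMap k[X] (RatFunc k) P⟯ (RatFunc k) = P.natDegree := by
  rw [RatFunc.finrank_eq_max_natDegree, RatFunc.num_algebraMap, RatFunc.denom_algebraMap,
    natDegree_one, Nat.max_zero]

-- The index of `k(P, Q)` in `k(t)` divides the indices `deg P` and `deg Q` of `k(P)` and `k(Q)`.
lemma adjoin_pair_eq_top (hPQ : P.natDegree.Coprime Q.natDegree) :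
    k⟮algebraMap k[X] (RatFunc k) P, algebraMap k[X] (RatFunc k) Q⟯ = ⊤ := by
  rw [← IntermediateField.finrank_eq_one_iff_eq_top]
  refine Nat.eq_one_of_dvd_coprimes hPQ ?_ ?_ <;> rw [← finrank_adjoin_algebraMap] <;>
    refine IntermediateField.finrank_dvd_of_le_left (IntermediateField.adjoin.mono _ _ _ ?_) <;>
    simp

lemma natDegree_minpoly_algebraMap (hP : 0 < P.natDegree)
    (hPQ : P.natDegree.Coprime Q.natDegree) :
    (minpoly k⟮algebraMap k[X] (RatFunc k) P⟯ (algebraMap k[X] (RatFunc k) Q)).natDegree =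
      P.natDegree := by
  have : FiniteDimensional k⟮algebraMap k[X] (RatFunc k) P⟯ (RatFunc k) :=
    Module.finite_of_finrank_pos (by rwa [finrank_adjoin_algebraMap])
  rw [(Field.primitive_element_iff_minpoly_natDegree_eq _ _).1, finrank_adjoin_algebraMap]
  rw [← IntermediateField.restrictScalars_eq_top_iff (K := k),
    IntermediateField.adjoin_simple_adjoin_simple, adjoin_pair_eq_top hPQ]

lemma eq_zero_of_aevalAeval_eq_zero (hPQ : P.natDegree.Coprime Q.natDegree) {r : k[X][Y]}
    (hr : r.degree < P.natDegree) (h : aevalAeval P Q r = 0) : r = 0 := by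
  by_contra hr0
  have hr' : r.natDegree < P.natDegree := (natDegree_lt_iff_degree_lt hr0).2 hr
  set p := algebraMap k[X] (RatFunc k) P with hp
  set q := algebraMap k[X] (RatFunc k) Q with hq
  let φ : k[X] →ₐ[k] k⟮p⟯ := aeval (IntermediateField.AdjoinSimple.gen k p)
  have hφ : Function.Injective φ := by
    have hP0 : 0 < P.natDegree := (Nat.zero_le _).trans_lt hr'
    have hP : Transcendental k P := transcendental P hP0.ne' <|
      mem_nonZeroDivisors_of_ne_zero <| leadingCoeff_ne_zero.2 <| ne_zero_of_natDegree_gt hP0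
    exact transcendental_iff_injective.1 <| (transcendental_algebraMap_iff
      (algebraMap k⟮p⟯ (RatFunc k)).injective).1 <|
        (transcendental_algebraMap_iff (RatFunc.algebraMap_injective k)).2 hP
  have hcomp : ((aeval q).restrictScalars k).comp (mapAlgHom φ) =
      (IsScalarTower.toAlgHom k k[X] (RatFunc k)).comp (aevalAeval P Q) := by
    ext <;> simp [φ, hp, hq]
  have hroot : aeval q (r.map (φ : k[X] →+* k⟮p⟯)) = 0 := by
    simpa [h] using DFunLike.congr_fun hcomp r
  have hdeg := natDegree_le_natDegree <| minpoly.degree_le_of_ne_zero k⟮p⟯ q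
    ((Polynomial.map_ne_zero_iff hφ).2 hr0) hroot
  rw [natDegree_minpoly_algebraMap (by omega) hPQ] at hdeg
  exact absurd (hdeg.trans natDegree_map_le) hr'.not_ge

lemma aeval_equivMvPolynomial {R A : Type*} [CommRing R] [CommRing A] [Algebra R A] (x y : A)
    (F : R[X][Y]) :
    MvPolynomial.aeval ![x, y] (equivMvPolynomial R F) = aevalAeval x y F := by
  suffices h : (MvPolynomial.aeval ![x, y]).comp (equivMvPolynomial R : R[X][Y] →ₐ[R] _) =
      aevalAeval x y from DFunLike.congr_fun h F
  ext <;> simp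

lemma ker_aeval_eq_span_singleton (hPQ : P.natDegree.Coprime Q.natDegree) {F : k[X][Y]}
    (hF : F.Monic) (hFd : F.natDegree = P.natDegree) (h0 : aevalAeval P Q F = 0) :
    RingHom.ker (MvPolynomial.aeval (R := k) ![P, Q]) = Ideal.span {equivMvPolynomial k F} := by
  refine le_antisymm (fun g hg => ?_) ((Ideal.span_singleton_le_iff_mem _).2 ?_)
  · obtain ⟨G, rfl⟩ := (equivMvPolynomial k).surjective g
    rw [RingHom.mem_ker, aeval_equivMvPolynomial] at hg
    have hmod : aevalAeval P Q (G %ₘ F) = 0 := by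
      rw [modByMonic_eq_sub_mul_div, map_sub, map_mul, hg, h0, zero_mul, sub_zero]
    have hdvd : F ∣ G := by
      rw [← modByMonic_eq_zero_iff_dvd hF]
      refine eq_zero_of_aevalAeval_eq_zero hPQ ?_ hmod
      rw [← hFd, ← degree_eq_natDegree hF.ne_zero]
      exact degree_modByMonic_lt G hF
    exact Ideal.mem_span_singleton.2 (map_dvd _ hdvd)
  · rw [RingHom.mem_ker, aeval_equivMvPolynomial, h0]

end Parametrization

section RationalCurve

open Polynomial Polynomial.Bivariate

variable {P Q : ℂ[X]} {f : MvPolynomial (Fin 2) ℂ}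

lemma nonempty_fractionRing_algEquiv (hPQ : P.natDegree.Coprime Q.natDegree)
    (hker : RingHom.ker (MvPolynomial.aeval (R := ℂ) ![P, Q]) = Ideal.span {f}) :
    Nonempty (FractionRing (CoordRing f) ≃ₐ[ℂ] RatFunc ℂ) := by
  let φ : CoordRing f →ₐ[ℂ] ℂ[X] := Ideal.Quotient.liftₐ (Ideal.span {f})
    (MvPolynomial.aeval ![P, Q]) fun x hx => hker.ge hx
  have hφ : Function.Injective φ := by
    rw [injective_iff_map_eq_zero]
    intro x hx
    obtain ⟨x, rfl⟩ := Ideal.Quotient.mk_surjective x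
    exact Ideal.Quotient.eq_zero_iff_mem.2 (hker.le hx)
  have : IsDomain (CoordRing f) := hφ.isDomain φ.toRingHom
  let ψ : CoordRing f →ₐ[ℂ] RatFunc ℂ := (Algebra.algHom ℂ ℂ[X] (RatFunc ℂ)).comp φ
  have hψ : Function.Injective ψ := (RatFunc.algebraMap_injective ℂ).comp hφ
  let Ψ : FractionRing (CoordRing f) →ₐ[ℂ] RatFunc ℂ := IsFractionRing.liftAlgHom hψ
  have hmem (i : Fin 2) : algebraMap ℂ[X] (RatFunc ℂ) (![P, Q] i) ∈ Ψ.fieldRange :=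
    ⟨algebraMap _ _ (Ideal.Quotient.mk _ (MvPolynomial.X i)),
      (IsFractionRing.lift_algebraMap hψ _).trans <|
        congrArg (algebraMap ℂ[X] (RatFunc ℂ)) (MvPolynomial.aeval_X _ i)⟩
  have hsurj : Function.Surjective Ψ := by
    rw [← AlgHom.fieldRange_eq_top, eq_top_iff, ← adjoin_pair_eq_top hPQ,
      IntermediateField.adjoin_le_iff]
    exact Set.pair_subset (hmem 0) (hmem 1)
  exact ⟨AlgEquiv.ofBijective Ψ ⟨Ψ.injective, hsurj⟩⟩

lemma IsRationalCurve.hasGenus_zero (hf : IsRationalCurve f) : HasGenus f 0 := by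
  have : (Ideal.span {f}).IsPrime := (Ideal.span_singleton_prime hf.1.ne_zero).2 hf.1.prime
  obtain ⟨e⟩ := hf.2
  refine ⟨Ideal.Quotient.isDomain _, ?_⟩
  rw [regularDifferentials_eq_bot e, rank_bot, Nat.cast_zero]

theorem isRationalCurve_of_aevalAeval_eq_zero (hPQ : P.natDegree.Coprime Q.natDegree)
    {F : ℂ[X][Y]} (hF : F.Monic) (hFd : F.natDegree = P.natDegree) (h0 : aevalAeval P Q F = 0) :
    IsRationalCurve (equivMvPolynomial ℂ F) := by
  have hker := ker_aeval_eq_span_singleton hPQ hF hFd h0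
  have hprime : (Ideal.span {equivMvPolynomial ℂ F}).IsPrime := hker ▸ RingHom.ker_isPrime _
  have hF0 : equivMvPolynomial ℂ F ≠ 0 := by simpa using hF.ne_zero
  exact ⟨((Ideal.span_singleton_prime hF0).1 hprime).irreducible,
    nonempty_fractionRing_algEquiv hPQ hker⟩

section Bivariate

variable {R : Type*} [CommRing R] (a b : R)

lemma natDegree_curve35 [Nontrivial R] :
    (curve35 (C (C a)) (C (C b)) (C X) X : R[X][Y]).natDegree = 3 := by
  rw [curve35]
  compute_degree!

lemma monic_curve35 : (curve35 (C (C a)) (C (C b)) (C X) X : R[X][Y]).Monic := by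
  rw [curve35]
  monicity!

lemma natDegree_curve56 [Nontrivial R] :
    (curve56 (C (C a)) (C (C b)) (C X) X : R[X][Y]).natDegree = 5 := by
  rw [curve56]
  compute_degree!

lemma monic_curve56 : (curve56 (C (C a)) (C (C b)) (C X) X : R[X][Y]).Monic := by
  rw [curve56]
  monicity!

end Bivariate

theorem isRationalCurve_plane35 (a b : ℂ) : IsRationalCurve (plane35 a b) := by
  have hE := constraints_solution a b
  have hdeg := natDegree_genPoly ((constraints_iff _).1 hE).1
  have hplane : equivMvPolynomial ℂ (curve35 (C (C a)) (C (C b)) (C X) X) = plane35 a b := by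
    rw [map_curve35, equivMvPolynomial_C_C, equivMvPolynomial_C_C, equivMvPolynomial_C_X,
      equivMvPolynomial_X, plane35]
  rw [← hplane]
  refine isRationalCurve_of_aevalAeval_eq_zero (P := genPoly (solution a b) i3)
    (Q := genPoly (solution a b) i5) ?_ (monic_curve35 a b) ?_ ?_
  · rw [hdeg, hdeg]
    norm_num [i3, i5]
  · rw [hdeg, natDegree_curve35, i3]
  · rw [map_curve35]
    simpa [solution_i3] using curve35_genPoly hE

theorem isRationalCurve_plane56 (a b : ℂ) : IsRationalCurve (plane56 a b) := by
  have hE := constraints_solution a b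
  have hdeg := natDegree_genPoly ((constraints_iff _).1 hE).1
  have hplane : equivMvPolynomial ℂ (curve56 (C (C a)) (C (C b)) (C X) X) = plane56 a b := by
    rw [map_curve56, equivMvPolynomial_C_C, equivMvPolynomial_C_C, equivMvPolynomial_C_X,
      equivMvPolynomial_X, plane56]
  rw [← hplane]
  refine isRationalCurve_of_aevalAeval_eq_zero (P := genPoly (solution a b) i5)
    (Q := genPoly (solution a b) i6) ?_ (monic_curve56 a b) ?_ ?_
  · rw [hdeg, hdeg]
    norm_num [i5, i6]
  · rw [hdeg, natDegree_curve56, i5]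
  · rw [map_curve56]
    simpa [solution_i3] using curve56_genPoly hE

end RationalCurve

end BirkhoffFive

end

theorem mainTheorem9 :
    -- closed subspaces of a point of the stratum only have the orders 3, 5, 6, 7, …
    (∀ W ∈ BirkhoffFive.stratum 5, ∀ V : Submodule ℂ (LaurentSeries ℂ), V ≤ W →
      BirkhoffFive.MulClosed V → ∀ f ∈ V, ∀ n : ℤ, BirkhoffFive.HasOrder f n →
        n ∈ BirkhoffFive.closedOrders) ∧
    -- a closed span of members of a canonical basis only uses p_3, p_5, p_6, …; and
    -- the span of p_3, p_5, p_6, …, when closed, is a maximal closed subspace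
    (∀ W ∈ BirkhoffFive.stratum 5, ∀ p : ℤ → LaurentSeries ℂ,
      BirkhoffFive.IsCanonicalBasis 5 W p →
      (∀ T ⊆ BirkhoffFive.stratumIndex 5,
        BirkhoffFive.MulClosed (Submodule.span ℂ (p '' T)) → T ⊆ BirkhoffFive.closedOrders) ∧
      (BirkhoffFive.MulClosed (Submodule.span ℂ (p '' BirkhoffFive.closedOrders)) →
        ∀ V : Submodule ℂ (LaurentSeries ℂ), V ≤ W → BirkhoffFive.MulClosed V →
          Submodule.span ℂ (p '' BirkhoffFive.closedOrders) ≤ V →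
          V = Submodule.span ℂ (p '' BirkhoffFive.closedOrders))) ∧
    -- closedness at fixed H^j_k, and the structure constants
    (∀ H : BirkhoffFive.Idx → ℤ → ℂ, H BirkhoffFive.i3 (-4) = 0 →
      (((∃ C : BirkhoffFive.Idx → BirkhoffFive.Idx → (BirkhoffFive.Idx →₀ ℂ), ∀ j k,
            BirkhoffFive.series H j * BirkhoffFive.series H k =
              (C j k).sum fun l c => c • BirkhoffFive.series H l) ∧
          BirkhoffFive.SqInvariant (Submodule.span ℂ (Set.range (BirkhoffFive.series H)))) ↔
        ((∀ j, ∀ k : ℤ, 1 ≤ k → H j k = 0) ∧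
          BirkhoffFive.Constraints (BirkhoffFive.evenPart H))) ∧
      (BirkhoffFive.SqInvariant (Submodule.span ℂ (Set.range (BirkhoffFive.series H))) →
        ∀ C : BirkhoffFive.Idx → BirkhoffFive.Idx → (BirkhoffFive.Idx →₀ ℂ),
          (∀ j k, BirkhoffFive.series H j * BirkhoffFive.series H k =
              (C j k).sum fun l c => c • BirkhoffFive.series H l) →
          ∀ j k l, C j k l = BirkhoffFive.structConst (BirkhoffFive.evenPart H) j k l)) ∧
    -- the constraints leave H^3_{-2} and H^3_0 free and determine the rest
    (∀ a b : ℂ, ∃! E : BirkhoffFive.Idx → Fin 3 → ℂ,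
      BirkhoffFive.Constraints E ∧ E BirkhoffFive.i3 1 = a ∧ E BirkhoffFive.i3 0 = b) ∧
    -- the points of W_5
    (∀ U : Submodule ℂ (LaurentSeries ℂ), U ∈ BirkhoffFive.W5 ↔
      ∃! E : BirkhoffFive.Idx → Fin 3 → ℂ, BirkhoffFive.Constraints E ∧
        U = Submodule.span ℂ (Set.range fun j =>
          BirkhoffFive.polyToLaurent (BirkhoffFive.basisPoly E j))) ∧
    -- the algebras A_5 and the fibres of Γ_5
    (∀ E : BirkhoffFive.Idx → Fin 3 → ℂ, BirkhoffFive.Constraints E →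
      (∃ (A : NonUnitalSubalgebra ℂ (Polynomial ℂ)) (β : Module.Basis BirkhoffFive.Idx ℂ A),
        (∀ j, (β j : Polynomial ℂ) = BirkhoffFive.basisPoly E j) ∧
        ¬ Module.Finite ℂ A ∧
        ∀ j k l, β.repr (β j * β k) l = BirkhoffFive.structConst E j k l) ∧
      RingHom.ker (MvPolynomial.aeval (R := ℂ) (BirkhoffFive.basisPoly E)) =
        BirkhoffFive.fibreIdeal E) ∧
    -- the plane curves in the ideal of Γ_5
    BirkhoffFive.curve35 (BirkhoffFive.hVar BirkhoffFive.i3 1) (BirkhoffFive.hVar BirkhoffFive.i3 0)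
      (BirkhoffFive.pVar BirkhoffFive.i3) (BirkhoffFive.pVar BirkhoffFive.i5) ∈
        BirkhoffFive.gammaIdeal ∧
    BirkhoffFive.curve56 (BirkhoffFive.hVar BirkhoffFive.i3 1) (BirkhoffFive.hVar BirkhoffFive.i3 0)
      (BirkhoffFive.pVar BirkhoffFive.i5) (BirkhoffFive.pVar BirkhoffFive.i6) ∈
        BirkhoffFive.gammaIdeal ∧
    -- they are rational, of genus zero
    (∀ a b : ℂ, BirkhoffFive.IsRationalCurve (BirkhoffFive.plane35 a b) ∧
      BirkhoffFive.HasGenus (BirkhoffFive.plane35 a b) 0 ∧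
      BirkhoffFive.IsRationalCurve (BirkhoffFive.plane56 a b) ∧
      BirkhoffFive.HasGenus (BirkhoffFive.plane56 a b) 0) := by
  open BirkhoffFive in
  exact ⟨fun _ hW _ hVW hV f hf n hn => orders_subset_closedOrders hW hVW hV ⟨f, hf, hn⟩,
    fun _ hW _ hp => ⟨fun _ hT hmul => subset_closedOrders_of_mulClosed hW hp hT hmul,
      fun _ _ hVW hV hle => eq_span_closedOrders_of_le hW hp hVW hV hle⟩,
    fun _ hH => ⟨closed_series_iff hH, fun hsq _ hC => structConst_of_series hsq hH hC⟩,
    existsUnique_constraints,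
    mem_W5_iff,
    fun _ hE => ⟨exists_polyAlgebra hE, ker_aeval_genPoly hE⟩,
    curve35_mem_gammaIdeal,
    curve56_mem_gammaIdeal,
    fun a b => ⟨isRationalCurve_plane35 a b, (isRationalCurve_plane35 a b).hasGenus_zero,
      isRationalCurve_plane56 a b, (isRationalCurve_plane56 a b).hasGenus_zero⟩⟩
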